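/- Let $n\ge 1$, $1<p\le 2$, $\frac1p+\frac1{p'}=1$ and $s\ge n(p'-2)/p'$. Let $\mathcal F$ denote the Fourier transform, $\mathcal F f(\xi)=\int f(x)e^{-2\pi i x\cdot\xi}\,dx$, and put $$\|f\|_{H^{r,q}(\mathbb R^n)}=\big\|\mathcal F^{-1}\big((1+|\xi|^2)^{r/2}\mathcal F f\big)\big\|_{L^q(\mathbb R^n)},$$ with value $\infty$ for tempered distributions $f$ for which $\mathcal F^{-1}((1+|\xi|^2)^{r/2}\mathcal F f)\notin L^q$. For $\theta\in S^{n-1}$ and $\sigma\in\mathbb R$ let $Rf(\sigma,\theta)=\int_{x\cdot\theta=\sigma}f(x)\,dx$ be the Radon transform. For a sinogram $g(\sigma,\theta)$ let $$\|g\|_{R^{r,q}_t(\mathbb R\times S^{n-1})}=\Big(\int_{S^{n-1}}\int_{\mathbb R}\big|v_{r,t}(\tau)\,(\mathcal F_\sigma g)(\tau,\theta)\big|^q\,d\tau\,d\theta\Big)^{1/q},\qquad v_{r,t}(\tau)=(1+\tau^2)^{r/2}\Big(\frac{|\tau|}{(1+\tau^2)^{1/2}}\Big)^t,$$ where $\mathcal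 F_\sigma$ is the one-dimensional Fourier transform in $\sigma$, and let $R^{r,q}_t(\mathbb R\times S^{n-1})$ be the completion of the Schwartz space $\mathcal S(\mathbb R\times S^{n-1})$ under this norm. Then there are constants $c,C>0$ depending only on $n,p,s$ such that $$c\,\|f\|_{H^{s-n(p'-2)/p',\,p'}(\mathbb R^n)}\;\le\;\|Rf\|_{R^{s+(n-1)/p',\,p'}_{(np'-n-1)/p'}(\mathbb R\times S^{n-1})}\;\le\;C\,\|f\|_{H^{s,p}(\mathbb R^n)}\qquad(\ast)$$ in the following two senses. 1. $(\ast)$ holds for every complex-valued $f\in L^1(\mathbb R^n)$, with $Rf$ defined by the integral over hyperplanes (values $\infty$ being allowed). 2. Let $\mathcal R$ be the closure, in $\mathcal S'(\mathbb R^n)\times R^{s+(n-1)/p',p'}_{(np'-n-1)/p'}$ (with the topology of pointwise convergence on $\mathcal S'$), of the graph $\{(f,Rf): f\in\mathcal S(\mathbb R^n)\}$. For every $f\in H^{s,p}(\mathbb R^n)$ there is exactly one $g=:Rf$ with $(f,g)\in\mathcal R$; and $(\ast)$ holds, with $g$ in place of $Rf$, for every $(f,g)\in\mathcal R$. -/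

import Mathlib

open MeasureTheory
open scoped ENNReal NNReal SchwartzMap FourierTransform

noncomputable section

namespace RadonBessel

/-- Euclidean space `ℝⁿ`. -/
abbrev E (n : ℕ) : Type := EuclideanSpace ℝ (Fin n)

/-- The unit sphere `S^{n-1}` of `ℝⁿ`. -/
abbrev Sph (n : ℕ) : Type := Metric.sphere (0 : E n) 1

/-- The surface measure on `S^{n-1}` (counting measure on the two points of `S⁰` if `n = 1`). -/
def sphereMeasure (n : ℕ) : Measure (Sph n) := (volume : Measure (E n)).toSphere

/-- The measure `dσ dθ` on the cylinder `ℝ × S^{n-1}`. -/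
def cylinderMeasure (n : ℕ) : Measure (ℝ × Sph n) :=
  (volume : Measure ℝ).prod (sphereMeasure n)

/-- The Radon transform `Rf(σ, θ) = ∫_{x·θ = σ} f(x) dx`. The hyperplane `x·θ = σ` is
parametrized isometrically by `y ↦ σ θ + y` with `y` in the orthogonal complement of `θ`, which
carries the Lebesgue measure of an orthonormal basis. -/
def radon {n : ℕ} (f : E n → ℂ) (σ : ℝ) (θ : Sph n) : ℂ :=
  ∫ y : (Submodule.span ℝ {(θ : E n)})ᗮ, f (σ • (θ : E n) + (y : E n))
    ∂((stdOrthonormalBasis ℝ (Submodule.span ℝ {(θ : E n)})ᗮ).toBasis.addHaar)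

/-- The weight `v_{s,t}(ξ) = (1 + |ξ|²)^{s/2} (|ξ| / (1 + |ξ|²)^{1/2})^t`. -/
def vWeight {V : Type*} [NormedAddCommGroup V] (s t : ℝ) (ξ : V) : ℝ :=
  (1 + ‖ξ‖ ^ 2) ^ (s / 2) * (‖ξ‖ / (1 + ‖ξ‖ ^ 2) ^ (1 / 2 : ℝ)) ^ t

/-- The norm `‖h‖_{S^{s,p}_t} = ‖v_{s,t} 𝓕 h‖_{L^p}` of a function `h` of one real variable. -/
def sNorm (s t : ℝ) (p : ℝ≥0∞) (h : ℝ → ℂ) : ℝ≥0∞ :=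
  eLpNorm (fun τ : ℝ => (vWeight s t τ : ℂ) * 𝓕 h τ) p volume

/-- The norm `‖g‖_{R^{s,p}_t} = (∫_{S^{n-1}} ‖g(·, θ)‖_{S^{s,p}_t(ℝ)}^p dθ)^{1/p}` of a sinogram
(for finite `p`), with value `∞` allowed. -/
def sinogramNorm {n : ℕ} (s t : ℝ) (p : ℝ≥0∞) (g : ℝ → Sph n → ℂ) : ℝ≥0∞ :=
  (∫⁻ θ : Sph n, sNorm s t p (fun σ => g σ θ) ^ p.toReal ∂(sphereMeasure n)) ^ (1 / p.toReal)

/-- The function `(τ, θ) ↦ v_{s,t}(τ) (𝓕_σ g)(τ, θ)` on the cylinder, whose `L^p`-norm with respect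
to `dτ dθ` is the sinogram norm of `g`. -/
def weightedFourier {n : ℕ} (s t : ℝ) (g : ℝ → Sph n → ℂ) (z : ℝ × Sph n) : ℂ :=
  (vWeight s t z.1 : ℂ) * 𝓕 (fun σ => g σ z.2) z.1

/-- The Schwartz functions on the cylinder `ℝ × S^{n-1}`: the restrictions of Schwartz functions
on the ambient space `ℝ × ℝⁿ`. -/
def IsSchwartzSinogram {n : ℕ} (g : ℝ → Sph n → ℂ) : Prop :=
  ∃ G : 𝓢(ℝ × E n, ℂ), ∀ (σ : ℝ) (θ : Sph n), g σ θ = G (σ, (θ : E n))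

/-- The sinogram space `R^{s,p}_t(ℝ × S^{n-1})`, the completion of the Schwartz functions on the
cylinder under the sinogram norm. Since `g ↦ v_{s,t} 𝓕_σ g` is a linear isometry from the
Schwartz functions with this norm into the Banach space `L^p(dτ dθ)`, the completion is realized
as the closure of its range, with the `L^p`-norm. -/
def SinogramSpace (n : ℕ) (s t : ℝ) (p : ℝ≥0∞) [Fact (1 ≤ p)] :
    Submodule ℂ (Lp ℂ p (cylinderMeasure n)) :=
  (Submodule.span ℂ {G : Lp ℂ p (cylinderMeasure n) |
    ∃ g : ℝ → Sph n → ℂ, IsSchwartzSinogram g ∧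
      (G : ℝ × Sph n → ℂ) =ᵐ[cylinderMeasure n] weightedFourier s t g}).topologicalClosure

/-- `G ∈ R^{s,p}_t` is the Radon transform of the tempered distribution `u`: the pair `(u, G)` lies
in the closure, in `𝓢' × R^{s,p}_t`, of the graph of the Radon transform on Schwartz functions. -/
def HasRadonTransform {n : ℕ} {s t : ℝ} {p : ℝ≥0∞} [Fact (1 ≤ p)]
    (u : 𝓢'(E n, ℂ)) (G : SinogramSpace n s t p) : Prop :=
  (u, G) ∈ closure {x : 𝓢'(E n, ℂ) × SinogramSpace n s t p |
    ∃ f : 𝓢(E n, ℂ), x.1 = (f : 𝓢'(E n, ℂ)) ∧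
      ((x.2 : Lp ℂ p (cylinderMeasure n)) : ℝ × Sph n → ℂ)
        =ᵐ[cylinderMeasure n] weightedFourier s t (radon f)}

/-- The Bessel potential norm `‖u‖_{H^{s,p}} = ‖𝓕⁻¹ ((1 + |ξ|²)^{s/2} 𝓕 u)‖_{L^p}` of a tempered
distribution, equal to `∞` unless `𝓕⁻¹ ((1 + |ξ|²)^{s/2} 𝓕 u)` is given by a (necessarily unique)
element of `L^p`. -/
def besselNorm {n : ℕ} (s : ℝ) (p : ℝ≥0∞) [Fact (1 ≤ p)] (u : 𝓢'(E n, ℂ)) : ℝ≥0∞ :=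
  ⨅ (g : Lp ℂ p (volume : Measure (E n)))
    (_ : TemperedDistribution.besselPotential (E n) ℂ s u = (g : 𝓢'(E n, ℂ))), ‖g‖ₑ

end RadonBessel

end

/-! By the Fourier slice theorem, `𝓕_σ (R f) (τ, θ) = 𝓕 f (τ θ)`, so the sinogram norm of `R f` is
the `L^{p'}` norm of `v_{r,t} 𝓕 f` for the image of `dτ dθ` under `(τ, θ) ↦ τ θ`, which is the polar
measure `2 |ξ|^{1-n} dξ`. For `r = s + (n - 1) / p'`, `t = n - (n + 1) / p'` and
`a = n (p' - 2) / p'`, this is, up to a constant, the `L^{p'}` norm of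
`|ξ|^a (1 + |ξ|²)^{(s - a) / 2} 𝓕 f` for Lebesgue measure.

The upper bound is the Hausdorff–Young inequality, as `|ξ|^a ≤ (1 + |ξ|²)^{a / 2}`. The lower bound
is the dual of Paley's inequality `‖|ξ|^{-a} 𝓕 φ‖_p ≤ C ‖φ‖_p`, where `a = n (2 - p) / p`. Both
follow from Hörmander's inequality: if `w ≥ 0` is in weak `L¹`, then `f ↦ 𝓕 f / w` is of weak type
`(1, 1)` and of strong type `(2, 2)` for the measure `w² dξ`, and one interpolates by Marcinkiewicz'
argument. Taking `w = |𝓕 f|^{p'}` gives the Hausdorff–Young inequality up to a constant, and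
`w = |ξ|^{-n}` Paley's.

In the closure of the graph, the relation that `G` is the pullback of `v_{r,t} 𝓕 u` survives,
because it is a family of identities between pairings with Schwartz functions, continuous in
`(u, G)`. Such a density determines the Bessel potential of `u`, and is determined by `u`. Existence
on `H^{s,p}` follows from the upper bound by the density of Schwartz functions. -/

namespace RadonBessel

open Set Filter

section FourierIntegrable

variable {V F : Type*} [NormedAddCommGroup V] [InnerProductSpace ℝ V] [FiniteDimensional ℝ V]
  [MeasurableSpace V] [BorelSpace V] [NormedAddCommGroup F] [NormedSpace ℂ F]

theorem continuous_fourier_of_integrable {f : V → F} (hf : Integrable f) : Continuous (𝓕 f) :=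
  VectorFourier.fourierIntegral_continuous Real.continuous_fourierChar
    (innerSL ℝ).continuous₂ hf

theorem norm_fourier_le_integral_norm (f : V → F) (ξ : V) : ‖𝓕 f ξ‖ ≤ ∫ x, ‖f x‖ :=
  VectorFourier.norm_fourierIntegral_le_integral_norm _ _ _ f ξ

theorem fourier_add_of_integrable {f g : V → F} (hf : Integrable f) (hg : Integrable g) :
    𝓕 (f + g) = 𝓕 f + 𝓕 g :=
  (VectorFourier.fourierIntegral_add Real.continuous_fourierChar (innerSL ℝ).continuous₂ hf hg :)

theorem integral_fourier_mul_eq_of_integrable {f g : V → ℂ} (hf : Integrable f)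
    (hg : Integrable g) : ∫ ξ, 𝓕 f ξ * g ξ = ∫ x, f x * 𝓕 g x := by
  have := VectorFourier.integral_fourierIntegral_smul_eq_flip (L := innerₗ V)
    (μ := volume) (ν := volume) Real.continuous_fourierChar (innerSL ℝ).continuous₂ hf hg
  simp only [flip_innerₗ, smul_eq_mul] at this
  exact this

end FourierIntegrable

section Plancherel

variable {V : Type*} [NormedAddCommGroup V] [InnerProductSpace ℝ V] [FiniteDimensional ℝ V]
  [MeasurableSpace V] [BorelSpace V]

theorem ae_eq_zero_of_integral_schwartz_mul_eq_zero {μ : Measure V} {f : V → ℂ}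
    (hf : LocallyIntegrable f μ) (h : ∀ ψ : 𝓢(V, ℂ), ∫ x, ψ x * f x ∂μ = 0) :
    ∀ᵐ x ∂μ, f x = 0 := by
  refine ae_eq_zero_of_integral_contDiff_smul_eq_zero hf fun g hg hc => ?_
  have hcompact : HasCompactSupport (Complex.ofRealCLM ∘ g) := hc.comp_left rfl
  have hsmooth : ContDiff ℝ (⊤ : ℕ∞) (Complex.ofRealCLM ∘ g) := by fun_prop
  simpa using h (hcompact.toSchwartzMap hsmooth)

theorem coeFn_fourier_toLp_ae_eq {f : V → ℂ} (hf : Integrable f) (hf2 : MemLp f 2) :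
    (𝓕 hf2.toLp : Lp ℂ 2 (volume : Measure V)) =ᵐ[volume] 𝓕 f := by
  set Ff : Lp ℂ 2 (volume : Measure V) := 𝓕 hf2.toLp
  have hcont := continuous_fourier_of_integrable hf
  suffices ∀ᵐ ξ, Ff ξ - 𝓕 f ξ = 0 from this.mono fun ξ hξ => sub_eq_zero.1 hξ
  refine ae_eq_zero_of_integral_schwartz_mul_eq_zero
    (((Lp.memLp _).locallyIntegrable (by norm_num)).sub hcont.locallyIntegrable) fun ψ => ?_
  have hψL2 : Integrable fun ξ => ψ ξ * Ff ξ := (ψ.memLp 2 volume).integrable_mul (Lp.memLp _)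
  have hψL1 : Integrable fun ξ => ψ ξ * 𝓕 f ξ :=
    ψ.integrable.mul_bdd hcont.aestronglyMeasurable
      (Eventually.of_forall (norm_fourier_le_integral_norm f))
  have hdistr : ∫ x, 𝓕 ψ x * hf2.toLp f x = ∫ ξ, ψ ξ * Ff ξ := by
    have := congrArg (fun u : 𝓢'(V, ℂ) => u ψ) (Lp.fourier_toTemperedDistribution_eq hf2.toLp)
    simpa only [TemperedDistribution.fourier_apply, Lp.toTemperedDistribution_apply,
      smul_eq_mul] using this
  have hpair : ∫ ξ, ψ ξ * Ff ξ = ∫ ξ, ψ ξ * 𝓕 f ξ := calc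
    _ = ∫ x, 𝓕 ψ x * hf2.toLp f x := hdistr.symm
    _ = ∫ x, 𝓕 (ψ : V → ℂ) x * f x := by
      refine integral_congr_ae (hf2.coeFn_toLp.mono fun x hx => ?_)
      simp only [hx, SchwartzMap.fourier_coe]
    _ = _ := integral_fourier_mul_eq_of_integrable ψ.integrable hf
  simp only [mul_sub]
  rw [integral_sub hψL2 hψL1, hpair, sub_self]

theorem eLpNorm_fourier_two {f : V → ℂ} (hf : Integrable f) (hf2 : MemLp f 2) :
    eLpNorm (𝓕 f) 2 volume = eLpNorm f 2 volume := by
  rw [← eLpNorm_congr_ae (coeFn_fourier_toLp_ae_eq hf hf2), ← Lp.enorm_def,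
    ← eLpNorm_congr_ae hf2.coeFn_toLp, ← Lp.enorm_def, ← ofReal_norm, ← ofReal_norm,
    Lp.norm_fourier_eq]

theorem lintegral_norm_fourier_sq {f : V → ℂ} (hf : Integrable f) (hf2 : MemLp f 2) :
    ∫⁻ ξ, ENNReal.ofReal (‖𝓕 f ξ‖ ^ 2) = ∫⁻ x, ENNReal.ofReal (‖f x‖ ^ 2) := by
  have h := congrArg (· ^ 2) (eLpNorm_fourier_two hf hf2)
  have hsq (g : V → ℂ) : ∫⁻ x, ENNReal.ofReal (‖g x‖ ^ 2) = eLpNorm g 2 volume ^ 2 := by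
    have := eLpNorm_nnreal_pow_eq_lintegral (f := g) (μ := volume) (p := 2) two_ne_zero
    simpa [ENNReal.ofReal_pow] using this.symm
  rw [hsq, hsq]
  exact h

end Plancherel

section Marcinkiewicz

theorem lintegral_Ioo_rpow {a b : ℝ} (ha : -1 < a) (hb : 0 ≤ b) :
    ∫⁻ t in Ioo 0 b, ENNReal.ofReal (t ^ a) = ENNReal.ofReal (b ^ (a + 1) / (a + 1)) := by
  have hint : IntegrableOn (fun t : ℝ => t ^ a) (Ioo 0 b) :=
    (intervalIntegral.intervalIntegrable_rpow' ha (a := 0) (b := b)).1.mono_set Ioo_subset_Ioc_self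
  rw [← ofReal_integral_eq_lintegral_ofReal hint
    ((ae_restrict_mem measurableSet_Ioo).mono fun t ht => Real.rpow_nonneg ht.1.le _),
    ← integral_Ioc_eq_integral_Ioo, ← intervalIntegral.integral_of_le hb,
    integral_rpow (Or.inl ha), Real.zero_rpow (by linarith), sub_zero]

theorem lintegral_Ici_rpow {a b : ℝ} (ha : a < -1) (hb : 0 < b) :
    ∫⁻ t in Ici b, ENNReal.ofReal (t ^ a) = ENNReal.ofReal (b ^ (a + 1) / (-(a + 1))) := by
  rw [setLIntegral_congr Ioi_ae_eq_Ici.symm,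
    ← ofReal_integral_eq_lintegral_ofReal (integrableOn_Ioi_rpow_of_lt ha hb)
    ((ae_restrict_mem measurableSet_Ioi).mono fun t ht => Real.rpow_nonneg (hb.trans ht).le _),
    integral_Ioi_rpow_of_lt ha hb, div_neg, neg_div]

variable {α β : Type*} [MeasurableSpace α] [MeasurableSpace β] {μ : Measure α} {ν : Measure β}

theorem lintegral_mul_setLIntegral_swap [SFinite μ] [SFinite ν] {R : β → α → Prop}
    (hR : MeasurableSet {z : β × α | R z.1 z.2}) {k : β → ℝ≥0∞} (hk : Measurable k)
    {G : α → ℝ≥0∞} (hG : Measurable G) :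
    ∫⁻ t, k t * ∫⁻ x in {x | R t x}, G x ∂μ ∂ν = ∫⁻ x, G x * ∫⁻ t in {t | R t x}, k t ∂ν ∂μ := by
  set kG : β × α → ℝ≥0∞ := {z | R z.1 z.2}.indicator fun z => k z.1 * G z.2
  have hleft (t : β) : k t * ∫⁻ x in {x | R t x}, G x ∂μ = ∫⁻ x, kG (t, x) ∂μ := by
    have hRt : MeasurableSet {x | R t x} := measurable_prodMk_left hR
    rw [← lintegral_const_mul _ hG, ← lintegral_indicator hRt]
    rfl
  have hright (x : α) : G x * ∫⁻ t in {t | R t x}, k t ∂ν = ∫⁻ t, kG (t, x) ∂ν := by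
    have hRx : MeasurableSet {t | R t x} := measurable_prodMk_right hR
    rw [mul_comm, ← lintegral_mul_const _ hk, ← lintegral_indicator hRx]
    rfl
  simp_rw [hleft, hright]
  refine lintegral_lintegral_swap (Measurable.indicator ?_ hR).aemeasurable
  fun_prop

variable [SFinite μ] {g : α → ℝ} {p : ℝ}

theorem lintegral_rpow_mul_setLIntegral_lt (hp : 1 < p) (hg : Measurable g)
    (hg0 : ∀ x, 0 ≤ g x) :
    ∫⁻ t in Ioi (0 : ℝ), ENNReal.ofReal (t ^ (p - 2)) *
        ∫⁻ x in {x | t < g x}, ENNReal.ofReal (g x) ∂μ =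
      ENNReal.ofReal (1 / (p - 1)) * ∫⁻ x, ENNReal.ofReal (g x ^ p) ∂μ := by
  rw [lintegral_mul_setLIntegral_swap (R := fun t x => t < g x)
    (measurableSet_lt measurable_fst (hg.comp measurable_snd)) (by fun_prop) hg.ennreal_ofReal,
    ← lintegral_const_mul _ (hg.pow_const p).ennreal_ofReal]
  refine lintegral_congr fun x => ?_
  have hp1 : 0 < p - 1 := by linarith
  rw [Measure.restrict_restrict (s := {t | t < g x}) measurableSet_Iio,
    show {t | t < g x} ∩ Ioi 0 = Ioo 0 (g x) from inter_comm _ _,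
    lintegral_Ioo_rpow (by linarith) (hg0 x), ← ENNReal.ofReal_mul (hg0 x),
    ← ENNReal.ofReal_mul (by positivity), show p - 2 + 1 = p - 1 by ring]
  have hpow : g x * g x ^ (p - 1) = g x ^ p := by
    rw [← Real.rpow_one_add' (hg0 x) (by linarith), add_sub_cancel]
  rw [← hpow]
  ring_nf

theorem lintegral_rpow_mul_setLIntegral_le (hp : 1 < p) (hp2 : p < 2) (hg : Measurable g)
    (hg0 : ∀ x, 0 ≤ g x) :
    ∫⁻ t in Ioi (0 : ℝ), ENNReal.ofReal (t ^ (p - 3)) *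
        ∫⁻ x in {x | g x ≤ t}, ENNReal.ofReal (g x ^ 2) ∂μ =
      ENNReal.ofReal (1 / (2 - p)) * ∫⁻ x, ENNReal.ofReal (g x ^ p) ∂μ := by
  rw [lintegral_mul_setLIntegral_swap (R := fun t x => g x ≤ t)
    (measurableSet_le (hg.comp measurable_snd) measurable_fst) (by fun_prop)
    (hg.pow_const 2).ennreal_ofReal, ← lintegral_const_mul _ (hg.pow_const p).ennreal_ofReal]
  refine lintegral_congr fun x => ?_
  rcases (hg0 x).eq_or_lt with h0 | h0
  · simp [← h0, Real.zero_rpow (by linarith : p ≠ 0)]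
  have hp2' : 0 < 2 - p := by linarith
  rw [Measure.restrict_restrict (s := {t | g x ≤ t}) measurableSet_Ici,
    show {t | g x ≤ t} ∩ Ioi 0 = Ici (g x) from
      inter_eq_left.2 fun t ht => h0.trans_le ht, lintegral_Ici_rpow (by linarith) h0,
    ← ENNReal.ofReal_mul (by positivity), ← ENNReal.ofReal_mul (by positivity),
    show -(p - 3 + 1) = 2 - p by ring]
  have hpow : g x ^ 2 * g x ^ (p - 3 + 1) = g x ^ p := by
    rw [← Real.rpow_two, ← Real.rpow_add h0]
    ring_nf
  rw [← hpow]
  ring_nf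

/-- The weak type hypothesis is the one obtained by splitting a function at height `t`, so this is
the Marcinkiewicz interpolation between the weak types `(1, 1)` and `(2, 2)`. -/
theorem lintegral_rpow_le_of_meas_lt_le (hp : 1 < p) (hp2 : p < 2) {a : β → ℝ}
    (ha : Measurable a) (ha0 : ∀ x, 0 ≤ a x) (hg : Measurable g) (hg0 : ∀ x, 0 ≤ g x)
    {A B : ℝ} (hA : 0 ≤ A) (hB : 0 ≤ B)
    (h : ∀ t : ℝ, 0 < t → ν {x | t < a x} ≤
      ENNReal.ofReal (A / t) * ∫⁻ x in {x | t < g x}, ENNReal.ofReal (g x) ∂μ +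
      ENNReal.ofReal (B / t ^ 2) * ∫⁻ x in {x | g x ≤ t}, ENNReal.ofReal (g x ^ 2) ∂μ) :
    ∫⁻ x, ENNReal.ofReal (a x ^ p) ∂ν ≤
      ENNReal.ofReal (p * (A / (p - 1) + B / (2 - p))) * ∫⁻ x, ENNReal.ofReal (g x ^ p) ∂μ := by
  set L : ℝ → ℝ≥0∞ := fun t => ∫⁻ x in {x | t < g x}, ENNReal.ofReal (g x) ∂μ
  set K : ℝ → ℝ≥0∞ := fun t => ∫⁻ x in {x | g x ≤ t}, ENNReal.ofReal (g x ^ 2) ∂μ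
  have hL : Measurable L :=
    Antitone.measurable fun s t hst => lintegral_mono_set fun x hx => lt_of_le_of_lt hst hx
  have hlevel (t : ℝ) (ht : 0 < t) : ν {x | t < a x} * ENNReal.ofReal (t ^ (p - 1)) ≤
      ENNReal.ofReal A * (ENNReal.ofReal (t ^ (p - 2)) * L t) +
        ENNReal.ofReal B * (ENNReal.ofReal (t ^ (p - 3)) * K t) := by
    have hpow1 : A / t * t ^ (p - 1) = A * t ^ (p - 2) := by
      rw [show p - 1 = p - 2 + 1 by ring, Real.rpow_add_one ht.ne']
      field_simp
    have hpow2 : B / t ^ 2 * t ^ (p - 1) = B * t ^ (p - 3) := by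
      rw [show p - 1 = p - 3 + 2 by ring, Real.rpow_add ht, Real.rpow_two]
      field_simp
    refine (mul_le_mul_left (h t ht) _).trans_eq ?_
    rw [add_mul, mul_right_comm, ← ENNReal.ofReal_mul (by positivity), mul_right_comm (_ : ℝ≥0∞),
      ← ENNReal.ofReal_mul (by positivity), hpow1, hpow2, ENNReal.ofReal_mul hA,
      ENNReal.ofReal_mul hB, mul_assoc, mul_assoc]
  have hp1 : 0 < p - 1 := by linarith
  have hp2' : 0 < 2 - p := by linarith
  rw [lintegral_rpow_eq_lintegral_meas_lt_mul ν (Eventually.of_forall ha0) ha.aemeasurable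
    (by linarith), ENNReal.ofReal_mul (by linarith), mul_assoc]
  gcongr
  refine (setLIntegral_mono' measurableSet_Ioi hlevel).trans_eq ?_
  rw [lintegral_add_left (by fun_prop), lintegral_const_mul' _ _ ENNReal.ofReal_ne_top,
    lintegral_const_mul' _ _ ENNReal.ofReal_ne_top, lintegral_rpow_mul_setLIntegral_lt hp hg hg0,
    lintegral_rpow_mul_setLIntegral_le hp hp2 hg hg0, ← mul_assoc, ← mul_assoc, ← add_mul,
    ← ENNReal.ofReal_mul hA, ← ENNReal.ofReal_mul hB,
    ← ENNReal.ofReal_add (by positivity) (by positivity), mul_one_div, mul_one_div]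

end Marcinkiewicz

section PaleyWeight

/-- A Paley weight is a nonnegative function `w` in the unit ball of weak `L¹`, i.e.
`t |{w ≥ t}| ≤ 1` for all `t > 0`. These are the weights for which `f ↦ (𝓕 f) / w` is of weak type
`(1, 1)` with respect to the measure `w² dξ`. -/
structure IsPaleyWeight {α : Type*} [MeasurableSpace α] (μ : Measure α) (w : α → ℝ) : Prop where
  measurable : Measurable w
  nonneg : ∀ x, 0 ≤ w x
  mul_meas_ge_le_one : ∀ t : ℝ, 0 < t → ENNReal.ofReal t * μ {x | t ≤ w x} ≤ 1

namespace IsPaleyWeight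

variable {α : Type*} [MeasurableSpace α] {μ : Measure α} {w : α → ℝ}

theorem of_lintegral_le_one (hw : Measurable w) (hw0 : ∀ x, 0 ≤ w x)
    (h : ∫⁻ x, ENNReal.ofReal (w x) ∂μ ≤ 1) : IsPaleyWeight μ w := by
  refine ⟨hw, hw0, fun t _ => le_trans ?_ h⟩
  refine le_trans ?_ (mul_meas_ge_le_lintegral hw.ennreal_ofReal (ENNReal.ofReal t))
  gcongr with x
  exact fun hx => ENNReal.ofReal_le_ofReal hx

theorem setLIntegral_sq_le (hw : IsPaleyWeight μ w) {a : ℝ} (ha : 0 ≤ a) :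
    ∫⁻ x in {x | w x ≤ a}, ENNReal.ofReal (w x ^ 2) ∂μ ≤ ENNReal.ofReal (2 * a) := by
  have hmeas : MeasurableSet {x | w x ≤ a} := measurableSet_le hw.measurable measurable_const
  set f : α → ℝ := {x | w x ≤ a}.indicator w with hf
  have hf_le_w (x : α) : f x ≤ w x := indicator_le_self' (fun _ _ => hw.nonneg _) x
  have hf_le_a (x : α) : f x ≤ a := indicator_le' (fun _ h => h) (fun _ _ => ha) x
  have hf_sq : ∫⁻ x in {x | w x ≤ a}, ENNReal.ofReal (w x ^ 2) ∂μ =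
      ∫⁻ x, ENNReal.ofReal (f x ^ (2 : ℝ)) ∂μ := by
    rw [← lintegral_indicator hmeas]
    refine lintegral_congr fun x => ?_
    by_cases h : w x ≤ a <;> simp [hf, h]
  rw [hf_sq, lintegral_rpow_eq_lintegral_meas_lt_mul μ
    (Eventually.of_forall fun x => indicator_nonneg (fun x _ => hw.nonneg x) x)
    (hw.measurable.indicator hmeas).aemeasurable (by norm_num), ENNReal.ofReal_mul (by norm_num)]
  gcongr
  calc ∫⁻ t in Ioi (0 : ℝ), μ {x | t < f x} * ENNReal.ofReal (t ^ ((2 : ℝ) - 1))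
      ≤ ∫⁻ t in Ioi (0 : ℝ), (Iio a).indicator (fun _ => 1) t := by
        refine setLIntegral_mono' measurableSet_Ioi fun t (ht : 0 < t) => ?_
        rw [show (2 : ℝ) - 1 = 1 by norm_num, Real.rpow_one, mul_comm]
        rcases lt_or_ge t a with hta | hta
        · rw [indicator_of_mem (mem_Iio.2 hta)]
          refine le_trans ?_ (hw.mul_meas_ge_le_one t ht)
          gcongr with x
          exact fun hx => hx.le.trans (hf_le_w x)
        · have hempty : {x | t < f x} = ∅ :=
            eq_empty_of_forall_notMem fun x hx => not_lt.2 ((hf_le_a x).trans hta) hx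
          simp [hempty]
    _ = ENNReal.ofReal a := by
        rw [setLIntegral_indicator measurableSet_Iio, inter_comm, Ioi_inter_Iio]
        simp

end IsPaleyWeight

end PaleyWeight

section HausdorffYoungPaley

variable {V : Type*} [NormedAddCommGroup V] [InnerProductSpace ℝ V] [FiniteDimensional ℝ V]
  [MeasurableSpace V] [BorelSpace V] {w : V → ℝ} {f : V → ℂ}

theorem withDensity_sq_lt_norm_fourier_div_le_integral_norm (hw : IsPaleyWeight volume w)
    (hf : Integrable f) {t : ℝ} (ht : 0 < t) :
    volume.withDensity (fun ξ => ENNReal.ofReal (w ξ ^ 2)) {ξ | t < ‖𝓕 f ξ‖ / w ξ} ≤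
      ENNReal.ofReal (2 / t) * ∫⁻ x, ENNReal.ofReal ‖f x‖ := by
  set A : ℝ := ∫ x, ‖f x‖
  have hA0 : 0 ≤ A := integral_nonneg fun _ => norm_nonneg _
  have hmeas : MeasurableSet {ξ | t < ‖𝓕 f ξ‖ / w ξ} := measurableSet_lt measurable_const
    ((continuous_fourier_of_integrable hf).measurable.norm.div hw.measurable)
  have hsub : {ξ | t < ‖𝓕 f ξ‖ / w ξ} ⊆ {ξ | w ξ ≤ A / t} := by
    intro ξ (hξ : t < ‖𝓕 f ξ‖ / w ξ)
    rcases (hw.nonneg ξ).eq_or_lt with h0 | h0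
    · exact h0.symm.trans_le (by positivity)
    · rw [lt_div_iff₀ h0] at hξ
      exact (le_div_iff₀' ht).2 (hξ.le.trans (norm_fourier_le_integral_norm f ξ))
  rw [withDensity_apply _ hmeas, ← ofReal_integral_eq_lintegral_ofReal hf.norm
    (Eventually.of_forall fun _ => norm_nonneg _), ← ENNReal.ofReal_mul (by positivity)]
  refine (lintegral_mono_set hsub).trans ((hw.setLIntegral_sq_le (by positivity)).trans_eq ?_)
  rw [div_mul_eq_mul_div, mul_div_assoc]

theorem withDensity_sq_lt_norm_fourier_div_le_integral_norm_sq (hw : IsPaleyWeight volume w)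
    (hf : Integrable f) (hf2 : MemLp f 2) {t : ℝ} (ht : 0 < t) :
    volume.withDensity (fun ξ => ENNReal.ofReal (w ξ ^ 2)) {ξ | t < ‖𝓕 f ξ‖ / w ξ} ≤
      ENNReal.ofReal (1 / t ^ 2) * ∫⁻ x, ENNReal.ofReal (‖f x‖ ^ 2) := by
  have hFm : Measurable (𝓕 f) := (continuous_fourier_of_integrable hf).measurable
  have hmeas : MeasurableSet {ξ | t < ‖𝓕 f ξ‖ / w ξ} :=
    measurableSet_lt measurable_const (hFm.norm.div hw.measurable)
  rw [withDensity_apply _ hmeas, ← lintegral_norm_fourier_sq hf hf2,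
    ← lintegral_const_mul _ (hFm.norm.pow_const 2).ennreal_ofReal]
  refine (setLIntegral_mono' hmeas fun ξ (hξ : t < ‖𝓕 f ξ‖ / w ξ) => ?_).trans
    (setLIntegral_le_lintegral _ _)
  rw [← ENNReal.ofReal_mul (by positivity)]
  refine ENNReal.ofReal_le_ofReal ?_
  rw [one_div_mul_eq_div, ← div_pow]
  refine pow_le_pow_left₀ (hw.nonneg ξ) ?_ 2
  rcases (hw.nonneg ξ).eq_or_lt with h0 | h0
  · exact h0.symm.trans_le (by positivity)
  · rw [lt_div_iff₀ h0] at hξ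
    exact (le_div_iff₀' ht).2 hξ.le

theorem withDensity_sq_lt_norm_fourier_div_le (hw : IsPaleyWeight volume w) (hf : Integrable f)
    (hf2 : MemLp f 2) (hfm : Measurable f) {t : ℝ} (ht : 0 < t) :
    volume.withDensity (fun ξ => ENNReal.ofReal (w ξ ^ 2)) {ξ | t < ‖𝓕 f ξ‖ / w ξ} ≤
      ENNReal.ofReal (4 / t) * (∫⁻ x in {x | t < ‖f x‖}, ENNReal.ofReal ‖f x‖) +
      ENNReal.ofReal (4 / t ^ 2) * ∫⁻ x in {x | ‖f x‖ ≤ t}, ENNReal.ofReal (‖f x‖ ^ 2) := by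
  have hlarge : MeasurableSet {x | t < ‖f x‖} := measurableSet_lt measurable_const hfm.norm
  have hsmall : MeasurableSet {x | ‖f x‖ ≤ t} := measurableSet_le hfm.norm measurable_const
  set f₁ : V → ℂ := {x | t < ‖f x‖}.indicator f with hf₁
  set f₂ : V → ℂ := {x | ‖f x‖ ≤ t}.indicator f with hf₂
  have hint₁ : Integrable f₁ := hf.indicator hlarge
  have hint₂ : Integrable f₂ := hf.indicator hsmall
  have hnorm₁ : ∫⁻ x, ENNReal.ofReal ‖f₁ x‖ = ∫⁻ x in {x | t < ‖f x‖}, ENNReal.ofReal ‖f x‖ := by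
    rw [← lintegral_indicator hlarge]
    refine lintegral_congr fun x => ?_
    by_cases h : t < ‖f x‖ <;> simp [f₁, h]
  have hnorm₂ : ∫⁻ x, ENNReal.ofReal (‖f₂ x‖ ^ 2) =
      ∫⁻ x in {x | ‖f x‖ ≤ t}, ENNReal.ofReal (‖f x‖ ^ 2) := by
    rw [← lintegral_indicator hsmall]
    refine lintegral_congr fun x => ?_
    by_cases h : ‖f x‖ ≤ t <;> simp [f₂, h]
  have hadd : 𝓕 f = 𝓕 f₁ + 𝓕 f₂ := by
    rw [← fourier_add_of_integrable hint₁ hint₂, hf₁, hf₂,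
      show {x | ‖f x‖ ≤ t} = {x | t < ‖f x‖}ᶜ by ext; simp, indicator_self_add_compl]
  have hsub : {ξ | t < ‖𝓕 f ξ‖ / w ξ} ⊆
      {ξ | t / 2 < ‖𝓕 f₁ ξ‖ / w ξ} ∪ {ξ | t / 2 < ‖𝓕 f₂ ξ‖ / w ξ} := by
    intro ξ (hξ : t < ‖𝓕 f ξ‖ / w ξ)
    have htri : ‖𝓕 f ξ‖ / w ξ ≤ ‖𝓕 f₁ ξ‖ / w ξ + ‖𝓕 f₂ ξ‖ / w ξ := by
      rw [← add_div, hadd]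
      exact div_le_div_of_nonneg_right (norm_add_le _ _) (hw.nonneg ξ)
    by_contra! hcon
    simp only [mem_union, mem_ofPred_eq, not_or, not_lt] at hcon
    linarith
  refine (measure_mono hsub).trans ((measure_union_le _ _).trans (add_le_add ?_ ?_))
  · refine (withDensity_sq_lt_norm_fourier_div_le_integral_norm hw hint₁ (half_pos ht)).trans_eq ?_
    rw [hnorm₁, show 2 / (t / 2) = 4 / t by ring]
  · refine (withDensity_sq_lt_norm_fourier_div_le_integral_norm_sq hw hint₂
      (hf2.indicator hsmall) (half_pos ht)).trans_eq ?_
    rw [hnorm₂, show 1 / (t / 2) ^ 2 = 4 / t ^ 2 by ring]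

/-- The constant in the Hausdorff–Young–Paley inequality: the Marcinkiewicz constant for `p < 2`,
while the value at `p = 2`, where `4 / 0 = 0`, still dominates the Plancherel constant `1`. -/
noncomputable def paleyConst (p : ℝ) : ℝ≥0 := (max 1 (p * (4 / (p - 1) + 4 / (2 - p)))).toNNReal

theorem lintegral_norm_fourier_rpow_mul_le {p : ℝ} (hp : 1 < p) (hp2 : p ≤ 2)
    (hw : IsPaleyWeight volume w) (hf : Integrable f) (hf2 : MemLp f 2) (hfm : Measurable f) :
    ∫⁻ ξ, ENNReal.ofReal (‖𝓕 f ξ‖ ^ p * w ξ ^ (2 - p)) ≤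
      paleyConst p * ∫⁻ x, ENNReal.ofReal (‖f x‖ ^ p) := by
  have hconst : (paleyConst p : ℝ≥0∞) = ENNReal.ofReal (max 1 (p * (4 / (p - 1) + 4 / (2 - p)))) :=
    ENNReal.ofNNReal_toNNReal _
  rcases hp2.eq_or_lt with rfl | hp2
  · simp only [sub_self, Real.rpow_zero, mul_one, Real.rpow_two, lintegral_norm_fourier_sq hf hf2]
    refine le_mul_of_one_le_left' ?_
    rw [hconst, ENNReal.one_le_ofReal]
    exact le_max_left _ _
  have hwm := hw.measurable
  have hFm : Measurable (𝓕 f) := (continuous_fourier_of_integrable hf).measurable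
  calc ∫⁻ ξ, ENNReal.ofReal (‖𝓕 f ξ‖ ^ p * w ξ ^ (2 - p))
      = ∫⁻ ξ, ENNReal.ofReal ((‖𝓕 f ξ‖ / w ξ) ^ p)
          ∂volume.withDensity (fun ξ => ENNReal.ofReal (w ξ ^ 2)) := by
        rw [lintegral_withDensity_eq_lintegral_mul _ (by fun_prop) (by fun_prop)]
        refine lintegral_congr fun ξ => ?_
        rw [Pi.mul_apply, ← ENNReal.ofReal_mul (by positivity)]
        rcases (hw.nonneg ξ).eq_or_lt with h | h
        · rw [← h, Real.zero_rpow (by linarith)]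
          simp
        · rw [Real.div_rpow (norm_nonneg _) h.le, Real.rpow_sub h, Real.rpow_two]
          ring_nf
    _ ≤ ENNReal.ofReal (p * (4 / (p - 1) + 4 / (2 - p))) * ∫⁻ x, ENNReal.ofReal (‖f x‖ ^ p) :=
        lintegral_rpow_le_of_meas_lt_le hp hp2 (by fun_prop)
          (fun ξ => div_nonneg (norm_nonneg _) (hw.nonneg ξ)) hfm.norm (fun _ => norm_nonneg _)
          (by norm_num) (by norm_num)
          fun t ht => withDensity_sq_lt_norm_fourier_div_le hw hf hf2 hfm ht
    _ ≤ paleyConst p * ∫⁻ x, ENNReal.ofReal (‖f x‖ ^ p) := by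
        rw [hconst]
        gcongr
        exact le_max_right _ _

end HausdorffYoungPaley

section Exponents

variable {p q : ℝ≥0∞}

theorem one_lt_toReal (hp : 1 < p) (hp_top : p ≠ ∞) : 1 < p.toReal := by
  simpa using (ENNReal.toReal_lt_toReal ENNReal.one_ne_top hp_top).2 hp

theorem toReal_le_two (hp : p ≤ 2) : p.toReal ≤ 2 := by
  simpa using ENNReal.toReal_mono ENNReal.ofNat_ne_top hp

theorem ne_top_of_le_two (hp : p ≤ 2) : p ≠ ∞ := ne_top_of_le_ne_top ENNReal.ofNat_ne_top hp

theorem conjExponent_ne_top (hpq : p.HolderConjugate q) (hp : 1 < p) : q ≠ ∞ :=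
  ((hpq.symm.lt_top_iff_one_lt q p).2 hp).ne

theorem holderConjugate_toReal (hpq : p.HolderConjugate q) (hp : 1 < p) (hp_top : p ≠ ∞) :
    p.toReal.HolderConjugate q.toReal :=
  ENNReal.HolderConjugate.toReal_of_ne_top hp_top (conjExponent_ne_top hpq hp)

theorem two_le_conjExponent_toReal (hpq : p.HolderConjugate q) (hp : 1 < p) (hp2 : p ≤ 2) :
    2 ≤ q.toReal := by
  have hc := holderConjugate_toReal hpq hp (ne_top_of_le_two hp2)
  nlinarith [hc.mul_eq_add, hc.lt, toReal_le_two hp2]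

theorem eLpNorm_rpow_toReal {α F : Type*} [MeasurableSpace α] [NormedAddCommGroup F]
    (hp0 : p ≠ 0) (hp_top : p ≠ ∞) (f : α → F) (μ : Measure α) :
    eLpNorm f p μ ^ p.toReal = ∫⁻ x, ENNReal.ofReal (‖f x‖ ^ p.toReal) ∂μ := by
  have hP : 0 < p.toReal := ENNReal.toReal_pos hp0 hp_top
  rw [eLpNorm_eq_lintegral_rpow_enorm_toReal hp0 hp_top, ← ENNReal.rpow_mul,
    one_div_mul_cancel hP.ne', ENNReal.rpow_one]
  simp_rw [← ofReal_norm, ENNReal.ofReal_rpow_of_nonneg (norm_nonneg _) hP.le]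

end Exponents

section HausdorffYoung

variable {V : Type*} [NormedAddCommGroup V] [InnerProductSpace ℝ V] [FiniteDimensional ℝ V]
  [MeasurableSpace V] [BorelSpace V] {p q : ℝ≥0∞}

theorem eLpNorm_rpow_mul_fourier_le (hp : 1 < p) (hp2 : p ≤ 2) {w : V → ℝ} {f : V → ℂ}
    (hw : IsPaleyWeight volume w) (hf : Integrable f) (hf2 : MemLp f 2) (hfm : Measurable f) :
    eLpNorm (fun ξ => ((w ξ ^ (2 / p.toReal - 1) : ℝ) : ℂ) * 𝓕 f ξ) p volume ≤
      (paleyConst p.toReal : ℝ≥0∞) ^ (1 / p.toReal) * eLpNorm f p volume := by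
  have hp_top := ne_top_of_le_two hp2
  have hp0 : p ≠ 0 := (zero_lt_one.trans hp).ne'
  have hP := one_lt_toReal hp hp_top
  have hP0 : 0 < p.toReal := by linarith
  rw [← ENNReal.rpow_le_rpow_iff hP0, ENNReal.mul_rpow_of_nonneg _ _ hP0.le, ← ENNReal.rpow_mul,
    one_div_mul_cancel hP0.ne', ENNReal.rpow_one, eLpNorm_rpow_toReal hp0 hp_top,
    eLpNorm_rpow_toReal hp0 hp_top]
  refine (lintegral_congr fun ξ => ?_).trans_le
    (lintegral_norm_fourier_rpow_mul_le hP (toReal_le_two hp2) hw hf hf2 hfm)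
  have hwξ := hw.nonneg ξ
  rw [norm_mul, Complex.norm_real, Real.norm_of_nonneg (by positivity),
    Real.mul_rpow (by positivity) (norm_nonneg _), ← Real.rpow_mul hwξ, mul_comm, sub_mul, one_mul,
    div_mul_cancel₀ _ hP0.ne']

theorem isPaleyWeight_norm_rpow_neg_finrank [Nontrivial V] :
    IsPaleyWeight volume fun ξ : V =>
      (volume.real (Metric.ball (0 : V) 1))⁻¹ * ‖ξ‖ ^ (-Module.finrank ℝ V : ℝ) where
  measurable := by fun_prop
  nonneg ξ := by positivity
  mul_meas_ge_le_one t ht := by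
    set d : ℝ := (Module.finrank ℝ V : ℝ) with hd
    set b : ℝ := volume.real (Metric.ball (0 : V) 1)
    have hd0 : 0 < d := by simpa [hd] using Module.finrank_pos (R := ℝ) (M := V)
    have hb0 : 0 < b := ENNReal.toReal_pos (Metric.measure_ball_pos _ _ one_pos).ne'
      measure_ball_lt_top.ne
    set r : ℝ := (b⁻¹ / t) ^ d⁻¹ with hr
    have hr0 : 0 ≤ r := by positivity
    have hrd : r ^ Module.finrank ℝ V = b⁻¹ / t := by
      rw [← Real.rpow_natCast, hr, ← Real.rpow_mul (by positivity), inv_mul_cancel₀ hd0.ne',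
        Real.rpow_one]
    have hsub : {x : V | t ≤ b⁻¹ * ‖x‖ ^ (-d)} ⊆ Metric.closedBall (0 : V) r := by
      intro x (hx : t ≤ b⁻¹ * ‖x‖ ^ (-d))
      rw [mem_closedBall_zero_iff]
      rcases (norm_nonneg x).eq_or_lt with h | h
      · exact h.symm.trans_le hr0
      · rw [Real.rpow_neg h.le, ← div_eq_mul_inv, le_div_comm₀ ht (by positivity)] at hx
        have := Real.rpow_le_rpow (by positivity) hx (inv_nonneg.2 hd0.le)
        rwa [← Real.rpow_mul h.le, mul_inv_cancel₀ hd0.ne', Real.rpow_one] at this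
    calc ENNReal.ofReal t * volume {x : V | t ≤ b⁻¹ * ‖x‖ ^ (-d)}
        ≤ ENNReal.ofReal t * volume (Metric.closedBall (0 : V) r) := by gcongr
      _ = ENNReal.ofReal (t * ((b⁻¹ / t) * b)) := by
        rw [Measure.addHaar_closedBall _ _ hr0, hrd,
          ← ofReal_measureReal measure_ball_lt_top.ne, ← ENNReal.ofReal_mul (by positivity),
          ← ENNReal.ofReal_mul ht.le]
      _ = 1 := by rw [show t * ((b⁻¹ / t) * b) = 1 by field_simp, ENNReal.ofReal_one]

theorem exists_eLpNorm_norm_rpow_mul_fourier_le [Nontrivial V] (hp : 1 < p) (hp2 : p ≤ 2) :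
    ∃ C : ℝ≥0, ∀ f : 𝓢(V, ℂ),
      eLpNorm (fun ξ => ((‖ξ‖ ^ (-(Module.finrank ℝ V * (2 / p.toReal - 1)) : ℝ) : ℝ) : ℂ) *
        𝓕 (f : V → ℂ) ξ) p volume ≤ C * eLpNorm f p volume := by
  set b : ℝ := volume.real (Metric.ball (0 : V) 1)
  have hb0 : 0 < b := ENNReal.toReal_pos (Metric.measure_ball_pos _ _ one_pos).ne'
    measure_ball_lt_top.ne
  have hP : 0 < p.toReal := by linarith [one_lt_toReal hp (ne_top_of_le_two hp2)]
  set a : ℝ := b ^ (2 / p.toReal - 1) with ha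
  refine ⟨a.toNNReal * paleyConst p.toReal ^ (1 / p.toReal), fun f => ?_⟩
  have hweight (ξ : V) : ((‖ξ‖ ^ (-(Module.finrank ℝ V * (2 / p.toReal - 1)) : ℝ) : ℝ) : ℂ) *
      𝓕 (f : V → ℂ) ξ = (a : ℂ) • ((((b⁻¹ * ‖ξ‖ ^ (-Module.finrank ℝ V : ℝ)) ^
        (2 / p.toReal - 1) : ℝ) : ℂ) * 𝓕 (f : V → ℂ) ξ) := by
    rw [Real.mul_rpow (by positivity) (by positivity), ← Real.rpow_mul (norm_nonneg _), neg_mul,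
      Real.inv_rpow hb0.le, ← ha, smul_eq_mul, ← mul_assoc, ← Complex.ofReal_mul,
      mul_inv_cancel_left₀ (by positivity)]
  have hconst : ((a.toNNReal * paleyConst p.toReal ^ (1 / p.toReal) : ℝ≥0) : ℝ≥0∞) =
      ‖(a : ℂ)‖ₑ * (paleyConst p.toReal : ℝ≥0∞) ^ (1 / p.toReal) := by
    rw [← ofReal_norm, Complex.norm_real, Real.norm_of_nonneg (by positivity), ENNReal.coe_mul,
      ENNReal.coe_rpow_of_nonneg _ (by positivity)]
    rfl
  simp_rw [hweight]
  rw [hconst, mul_assoc]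
  refine (eLpNorm_const_smul (a : ℂ) _ p volume).trans_le ?_
  gcongr
  exact eLpNorm_rpow_mul_fourier_le hp hp2 isPaleyWeight_norm_rpow_neg_finrank f.integrable
    (f.memLp 2 volume) f.continuous.measurable

/-- The case of the Paley weight `|𝓕 f| ^ q`, whose integral is `1`. -/
theorem one_le_mul_eLpNorm_of_eLpNorm_fourier_eq_one (hpq : p.HolderConjugate q) (hp : 1 < p)
    (hp2 : p ≤ 2) {f : 𝓢(V, ℂ)} (hf : eLpNorm (𝓕 (f : V → ℂ)) q volume = 1) :
    1 ≤ (paleyConst p.toReal : ℝ≥0∞) ^ (1 / p.toReal) * eLpNorm f p volume := by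
  have hp_top := ne_top_of_le_two hp2
  have hq_top := conjExponent_ne_top hpq hp
  have hc := holderConjugate_toReal hpq hp hp_top
  have hFm : Measurable (𝓕 (f : V → ℂ)) :=
    (continuous_fourier_of_integrable f.integrable).measurable
  have hw : IsPaleyWeight volume fun ξ => ‖𝓕 (f : V → ℂ) ξ‖ ^ q.toReal :=
    .of_lintegral_le_one (by fun_prop) (fun ξ => by positivity) <| by
      rw [← eLpNorm_rpow_toReal hpq.symm.ne_zero hq_top, hf, ENNReal.one_rpow]
  have hexp : p * ENNReal.ofReal (q.toReal / p.toReal) = q := by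
    rw [ENNReal.ofReal_div_of_pos hc.pos, ENNReal.ofReal_toReal hq_top,
      ENNReal.ofReal_toReal hp_top, ENNReal.mul_div_cancel hpq.ne_zero hp_top]
  have hmul (ξ : V) : ‖(((‖𝓕 (f : V → ℂ) ξ‖ ^ q.toReal) ^ (2 / p.toReal - 1) : ℝ) : ℂ) *
      𝓕 (f : V → ℂ) ξ‖ = ‖‖𝓕 (f : V → ℂ) ξ‖ ^ (q.toReal / p.toReal)‖ := by
    rw [norm_mul, Complex.norm_real, Real.norm_of_nonneg (by positivity),
      Real.norm_of_nonneg (by positivity), ← Real.rpow_mul (norm_nonneg _)]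
    rcases (norm_nonneg (𝓕 (f : V → ℂ) ξ)).eq_or_lt with h | h
    · rw [← h, Real.zero_rpow (div_pos hc.symm.pos hc.pos).ne', mul_zero]
    · rw [← Real.rpow_add_one h.ne']
      congr 1
      have := hc.ne_zero
      field_simp
      linear_combination -hc.mul_eq_add
  calc (1 : ℝ≥0∞)
      = eLpNorm (fun ξ => (((‖𝓕 (f : V → ℂ) ξ‖ ^ q.toReal) ^ (2 / p.toReal - 1) : ℝ) : ℂ) *
          𝓕 (f : V → ℂ) ξ) p volume := by
        rw [eLpNorm_congr_norm_ae (Eventually.of_forall hmul),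
          eLpNorm_norm_rpow _ (div_pos hc.symm.pos hc.pos), hexp, hf, ENNReal.one_rpow]
    _ ≤ _ := eLpNorm_rpow_mul_fourier_le hp hp2 hw f.integrable (f.memLp 2 volume)
        f.continuous.measurable

theorem eLpNorm_fourier_le (hpq : p.HolderConjugate q) (hp : 1 < p) (hp2 : p ≤ 2) (f : 𝓢(V, ℂ)) :
    eLpNorm (𝓕 (f : V → ℂ)) q volume ≤
      (paleyConst p.toReal : ℝ≥0∞) ^ (1 / p.toReal) * eLpNorm f p volume := by
  have hF_top : eLpNorm (𝓕 (f : V → ℂ)) q volume ≠ ∞ := by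
    rw [← SchwartzMap.fourier_coe]
    exact ((𝓕 f).memLp q volume).2.ne
  rcases eq_or_ne (eLpNorm (𝓕 (f : V → ℂ)) q volume) 0 with h0 | h0
  · exact h0.trans_le zero_le
  set N : ℝ := (eLpNorm (𝓕 (f : V → ℂ)) q volume).toReal
  have hN0 : N ≠ 0 := (ENNReal.toReal_pos h0 hF_top).ne'
  have hN_enorm : ‖(N⁻¹ : ℂ)‖ₑ = (eLpNorm (𝓕 (f : V → ℂ)) q volume)⁻¹ := by
    rw [enorm_inv (by simpa using hN0), ← ofReal_norm, Complex.norm_real,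
      Real.norm_of_nonneg ENNReal.toReal_nonneg, ENNReal.ofReal_toReal hF_top]
  have hcoe_smul (c : ℂ) (g : 𝓢(V, ℂ)) : ((c • g : 𝓢(V, ℂ)) : V → ℂ) = c • (g : V → ℂ) := rfl
  have hnormalized : eLpNorm (𝓕 (((N⁻¹ : ℂ) • f : 𝓢(V, ℂ)) : V → ℂ)) q volume = 1 := by
    rw [← SchwartzMap.fourier_coe, FourierTransform.fourier_smul, hcoe_smul,
      SchwartzMap.fourier_coe, eLpNorm_const_smul, hN_enorm, ENNReal.inv_mul_cancel h0 hF_top]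
  have h := one_le_mul_eLpNorm_of_eLpNorm_fourier_eq_one hpq hp hp2 hnormalized
  rwa [hcoe_smul, eLpNorm_const_smul, hN_enorm, mul_left_comm, mul_comm,
    ← div_eq_mul_inv, ENNReal.le_div_iff_mul_le (Or.inl h0) (Or.inl hF_top), one_mul] at h

end HausdorffYoung

section TestFunction

variable {α : Type*} {P Q : ℝ} {g : α → ℂ} {A : Set α}

/-- The extremal test function `|g| ^ (Q - 2) * conj g`, truncated to `A`, in the duality between
`L^P` and `L^Q`. -/
noncomputable def dualTest (Q : ℝ) (A : Set α) (g : α → ℂ) : α → ℂ :=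
  A.indicator fun x => ((‖g x‖ ^ (Q - 2) : ℝ) : ℂ) * starRingEnd ℂ (g x)

theorem norm_dualTest (hQ : 1 < Q) (x : α) :
    ‖dualTest Q A g x‖ = A.indicator (fun x => ‖g x‖ ^ (Q - 1)) x := by
  by_cases hx : x ∈ A
  · simp only [dualTest, indicator_of_mem hx, norm_mul, RCLike.norm_conj, Complex.norm_real]
    rw [Real.norm_of_nonneg (by positivity)]
    rcases (norm_nonneg (g x)).eq_or_lt with h | h
    · rw [← h, mul_zero, Real.zero_rpow (by linarith)]
    · rw [← Real.rpow_add_one h.ne']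
      ring_nf
  · simp [dualTest, hx]

variable [MeasurableSpace α] {μ : Measure α}

theorem measurable_dualTest (hA : MeasurableSet A) (hg : Measurable g) :
    Measurable (dualTest Q A g) :=
  Measurable.indicator
    (Measurable.mul (by fun_prop) (Complex.continuous_conj.measurable.comp hg)) hA

theorem integral_dualTest_mul (hQ : 0 < Q) (hA : MeasurableSet A) :
    ∫ x, dualTest Q A g x * g x ∂μ = ((∫ x in A, ‖g x‖ ^ Q ∂μ : ℝ) : ℂ) := by
  rw [← integral_indicator hA, ← integral_complex_ofReal]
  refine integral_congr_ae (Eventually.of_forall fun x => ?_)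
  by_cases hx : x ∈ A
  · simp only [dualTest, indicator_of_mem hx]
    rw [mul_assoc, Complex.conj_mul', ← Complex.ofReal_pow, ← Complex.ofReal_mul]
    congr 1
    rcases (norm_nonneg (g x)).eq_or_lt with h | h
    · rw [← h, Real.zero_rpow hQ.ne']
      simp
    · rw [← Real.rpow_two, ← Real.rpow_add h]
      ring_nf
  · simp [dualTest, hx]

theorem integral_norm_dualTest_rpow (hc : P.HolderConjugate Q) (hA : MeasurableSet A) :
    ∫ x, ‖dualTest Q A g x‖ ^ P ∂μ = ∫ x in A, ‖g x‖ ^ Q ∂μ := by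
  rw [← integral_indicator hA]
  refine integral_congr_ae (Eventually.of_forall fun x => ?_)
  simp only [norm_dualTest hc.symm.lt]
  by_cases hx : x ∈ A
  · simp only [indicator_of_mem hx]
    rw [← Real.rpow_mul (norm_nonneg _), hc.symm.sub_one_mul_conj]
  · simp [hx, hc.ne_zero]

theorem le_rpow_of_le_mul_rpow_inv (hc : P.HolderConjugate Q) {I K : ℝ} (hI : 0 ≤ I) (hK : 0 ≤ K)
    (h : I ≤ K * I ^ P⁻¹) : I ≤ K ^ Q := by
  rcases hI.eq_or_lt with rfl | hI
  · positivity
  have hsplit : I ^ Q⁻¹ * I ^ P⁻¹ = I := by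
    rw [← Real.rpow_add hI, hc.symm.inv_add_inv_eq_one, Real.rpow_one]
  have hroot : I ^ Q⁻¹ ≤ K := by
    refine le_of_mul_le_mul_right (a := I ^ P⁻¹) ?_ (by positivity)
    rwa [hsplit]
  calc I = (I ^ Q⁻¹) ^ Q := (Real.rpow_inv_rpow hI.le hc.symm.ne_zero).symm
    _ ≤ K ^ Q := Real.rpow_le_rpow (by positivity) hroot hc.symm.nonneg

end TestFunction

section Duality

section Norm

variable {V : Type*} [NormedAddCommGroup V] [MeasurableSpace V] [ProperSpace V]
  {μ : Measure V} [IsFiniteMeasureOnCompacts μ] {p q : ℝ≥0∞} {g : V → ℂ}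
  {K : ℝ}

theorem setLIntegral_norm_rpow_le_of_norm_integral_mul_le (hpq : p.HolderConjugate q) (hp : 1 < p)
    (hp_top : p ≠ ∞) (hg : Measurable g) (hK : 0 ≤ K)
    (h : ∀ (h : V → ℂ) (M : ℝ), Measurable h → HasCompactSupport h → (∀ x, ‖h x‖ ≤ M) →
      ‖∫ x, h x * g x ∂μ‖ ≤ K * (eLpNorm h p μ).toReal)
    {A : Set V} (hA : MeasurableSet A) {R N : ℝ} (hAR : A ⊆ Metric.closedBall 0 R)
    (hgN : ∀ x ∈ A, ‖g x‖ ≤ N) (hN : 0 ≤ N) :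
    ∫⁻ x in A, ENNReal.ofReal (‖g x‖ ^ q.toReal) ∂μ ≤ ENNReal.ofReal (K ^ q.toReal) := by
  have hc := holderConjugate_toReal hpq hp hp_top
  have hint : IntegrableOn (fun x => ‖g x‖ ^ q.toReal) A μ := by
    refine Measure.integrableOn_of_bounded (M := N ^ q.toReal)
      ((measure_mono hAR).trans_lt measure_closedBall_lt_top).ne
      (hg.norm.pow_const _).aestronglyMeasurable ?_
    filter_upwards [ae_restrict_mem hA] with x hx
    rw [Real.norm_of_nonneg (by positivity)]
    exact Real.rpow_le_rpow (norm_nonneg _) (hgN x hx) hc.symm.nonneg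
  rw [← ofReal_integral_eq_lintegral_ofReal hint (Eventually.of_forall fun x => by positivity)]
  refine ENNReal.ofReal_le_ofReal (le_rpow_of_le_mul_rpow_inv hc (by positivity) hK ?_)
  have htest := measurable_dualTest (Q := q.toReal) hA hg
  have hcompact : HasCompactSupport (dualTest q.toReal A g) :=
    .of_support_subset_isCompact (isCompact_closedBall 0 R) (support_indicator_subset.trans hAR)
  have hbound (x : V) : ‖dualTest q.toReal A g x‖ ≤ N ^ (q.toReal - 1) := by
    rw [norm_dualTest hc.symm.lt]
    exact indicator_le'
      (fun x hx => Real.rpow_le_rpow (norm_nonneg _) (hgN x hx) hc.symm.sub_one_pos.le)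
      (fun x _ => by positivity) x
  have hmem : MemLp (dualTest q.toReal A g) p μ :=
    hcompact.memLp_of_bound htest.aestronglyMeasurable _ (Eventually.of_forall hbound)
  have key := h _ _ htest hcompact hbound
  rwa [integral_dualTest_mul hc.symm.pos hA, Complex.norm_real,
    Real.norm_of_nonneg (by positivity), hmem.eLpNorm_eq_integral_rpow_norm hpq.ne_zero hp_top,
    ENNReal.toReal_ofReal (by positivity), integral_norm_dualTest_rpow hc hA] at key

theorem eLpNorm_le_of_norm_integral_mul_le [OpensMeasurableSpace V]
    (hpq : p.HolderConjugate q) (hp : 1 < p) (hp_top : p ≠ ∞) (hg : Measurable g) (hK : 0 ≤ K)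
    (h : ∀ (h : V → ℂ) (M : ℝ), Measurable h → HasCompactSupport h → (∀ x, ‖h x‖ ≤ M) →
      ‖∫ x, h x * g x ∂μ‖ ≤ K * (eLpNorm h p μ).toReal) :
    eLpNorm g q μ ≤ ENNReal.ofReal K := by
  have hc := holderConjugate_toReal hpq hp hp_top
  set A : ℕ → Set V := fun N => {x | ‖x‖ ≤ N ∧ ‖g x‖ ≤ N}
  have hA (N : ℕ) : MeasurableSet (A N) :=
    (measurableSet_le measurable_norm measurable_const).inter
      (measurableSet_le hg.norm measurable_const)
  have hcover : AECover μ atTop A := by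
    refine ⟨Eventually.of_forall fun x => ?_, hA⟩
    filter_upwards [eventually_ge_atTop ⌈‖x‖⌉₊, eventually_ge_atTop ⌈‖g x‖⌉₊] with N h₁ h₂
    exact ⟨Nat.ceil_le.1 h₁, Nat.ceil_le.1 h₂⟩
  rw [← ENNReal.rpow_le_rpow_iff hc.symm.pos,
    eLpNorm_rpow_toReal hpq.symm.ne_zero (conjExponent_ne_top hpq hp),
    ENNReal.ofReal_rpow_of_nonneg hK hc.symm.nonneg]
  refine le_of_tendsto' (hcover.lintegral_tendsto_of_countably_generated
    (hg.norm.pow_const _).ennreal_ofReal.aemeasurable) fun N => ?_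
  exact setLIntegral_norm_rpow_le_of_norm_integral_mul_le hpq hp hp_top hg hK h (hA N)
    (fun x hx => mem_closedBall_zero_iff.2 hx.1) (fun x hx => hx.2) N.cast_nonneg

end Norm

variable {V : Type*} [NormedAddCommGroup V] [InnerProductSpace ℝ V] [FiniteDimensional ℝ V]
  [MeasurableSpace V] [BorelSpace V] {p q : ℝ≥0∞}

theorem memLp_one_add_norm_pow_mul_of_hasCompactSupport {h : V → ℂ} (hm : Measurable h)
    (hc : HasCompactSupport h) {M : ℝ} (hM : ∀ x, ‖h x‖ ≤ M) (k : ℕ) (r : ℝ≥0∞) :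
    MemLp (fun x => ((1 + ‖x‖ : ℝ) : ℂ) ^ k * h x) r volume := by
  obtain ⟨B, hB⟩ := hc.isCompact.exists_bound_of_continuousOn
    (f := fun x : V => ((1 + ‖x‖ : ℝ) : ℂ) ^ k) (by fun_prop)
  refine HasCompactSupport.memLp_of_bound hc.mul_left
    (Measurable.aestronglyMeasurable (by fun_prop)) (|B| * M) (Eventually.of_forall fun x => ?_)
  rw [norm_mul]
  by_cases hx : x ∈ tsupport h
  · exact mul_le_mul ((hB x hx).trans (le_abs_self B)) (hM x) (norm_nonneg _) (abs_nonneg B)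
  · rw [image_eq_zero_of_notMem_tsupport hx, norm_zero, mul_zero]
    exact mul_nonneg (abs_nonneg B) ((norm_nonneg _).trans (hM x))

theorem memLp_one_add_norm_pow_mul_schwartz (φ : 𝓢(V, ℂ)) (k : ℕ) (r : ℝ≥0∞) :
    MemLp (fun x => ((1 + ‖x‖ : ℝ) : ℂ) ^ k * φ x) r volume := by
  set w : V → ℂ := fun x => (((1 + ‖x‖ ^ 2) ^ (k : ℝ) : ℝ) : ℂ)
  have hw : w.HasTemperateGrowth := by fun_prop
  refine (((SchwartzMap.smulLeftCLM ℂ w φ).memLp r volume).const_mul ((2 : ℂ) ^ k)).mono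
    (Continuous.aestronglyMeasurable (by fun_prop)) (Eventually.of_forall fun x => ?_)
  rw [SchwartzMap.smulLeftCLM_apply_apply hw, smul_eq_mul, ← mul_assoc, norm_mul, norm_mul]
  gcongr
  rw [norm_mul, norm_pow, norm_pow, Complex.norm_real, Complex.norm_real,
    Real.norm_of_nonneg (by positivity), Real.norm_of_nonneg (by positivity),
    Real.rpow_natCast, Complex.norm_ofNat, ← mul_pow]
  gcongr
  nlinarith [sq_nonneg (‖x‖ - 1), sq_nonneg ‖x‖]

/-- Multiplication by a rapidly decaying function maps `L²` into `L^p`, so Riesz' representation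
theorem applies to the composition with the functional. -/
theorem exists_integral_repr_of_rapid_decay [Fact (1 ≤ p)] (hp2 : p ≤ 2)
    (Λ : Lp ℂ p (volume : Measure V) →L[ℂ] ℂ) :
    ∃ (k : ℕ) (g : V → ℂ), Measurable g ∧ ∀ (h : V → ℂ) (hh : MemLp h p volume),
      MemLp (fun x => ((1 + ‖x‖ : ℝ) : ℂ) ^ k * h x) 2 volume →
        Λ hh.toLp = ∫ x, h x * g x := by
  set r : ℝ≥0∞ := (p⁻¹ - 2⁻¹)⁻¹ with hr
  have : ENNReal.HolderTriple r 2 p := ⟨by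
    rw [hr, inv_inv, tsub_add_cancel_of_le (ENNReal.inv_le_inv.2 hp2)]⟩
  have : Fact (1 ≤ r) := ⟨by
    rw [hr, ENNReal.one_le_inv]
    exact tsub_le_self.trans (ENNReal.inv_le_one.2 Fact.out)⟩
  obtain ⟨k, hk⟩ := Measure.HasTemperateGrowth.exists_eLpNorm_lt_top r
    (μ := (volume : Measure V)) inferInstance
  have hη : MemLp (fun x : V => (((1 + ‖x‖) ^ (-k : ℝ) : ℝ) : ℂ)) r volume :=
    MemLp.ofReal ⟨Measurable.aestronglyMeasurable (by fun_prop), hk⟩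
  set Φ : Lp ℂ 2 (volume : Measure V) →L[ℂ] Lp ℂ p (volume : Measure V) :=
    (ContinuousLinearMap.mul ℂ ℂ).holderL (volume : Measure V) r 2 p hη.toLp
  set g₀ := (InnerProductSpace.toDual ℂ (Lp ℂ 2 (volume : Measure V))).symm (Λ ∘L Φ) with hg₀
  refine ⟨k, fun x => ((1 + ‖x‖ : ℝ) : ℂ) ^ k * starRingEnd ℂ (g₀ x),
    Measurable.mul (by fun_prop)
      (Complex.continuous_conj.measurable.comp (Lp.stronglyMeasurable g₀).measurable),
    fun h hh hk2 => ?_⟩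
  have hΦ : Φ hk2.toLp = hh.toLp := by
    refine Lp.ext ?_
    filter_upwards [(ContinuousLinearMap.mul ℂ ℂ).coeFn_holder (r := p) hη.toLp hk2.toLp,
      hη.coeFn_toLp, hk2.coeFn_toLp, hh.coeFn_toLp] with x hmul hη_x hk2_x hh_x
    have hx : (0 : ℝ) < 1 + ‖x‖ := by positivity
    refine hmul.trans ?_
    rw [hη_x, hk2_x, hh_x, ContinuousLinearMap.mul_apply', ← mul_assoc, Real.rpow_neg hx.le,
      Real.rpow_natCast, ← Complex.ofReal_pow, ← Complex.ofReal_mul,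
      inv_mul_cancel₀ (by positivity), Complex.ofReal_one, one_mul]
  have hΛ : Λ hh.toLp = inner ℂ g₀ hk2.toLp := by
    rw [← hΦ, hg₀, InnerProductSpace.toDual_symm_apply]
    rfl
  rw [hΛ, L2.inner_def]
  refine integral_congr_ae ?_
  filter_upwards [hk2.coeFn_toLp] with x hx
  rw [hx, RCLike.inner_apply]
  ring

theorem exists_Lp_repr_of_functional [Fact (1 ≤ p)] (hpq : p.HolderConjugate q) (hp : 1 < p)
    (hp2 : p ≤ 2) (Λ : Lp ℂ p (volume : Measure V) →L[ℂ] ℂ) :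
    ∃ g : Lp ℂ q (volume : Measure V), ‖g‖ ≤ ‖Λ‖ ∧
      ∀ φ : 𝓢(V, ℂ), Λ (φ.toLp p) = ∫ x, φ x * g x := by
  obtain ⟨k, g, hg, hΛ⟩ := exists_integral_repr_of_rapid_decay hp2 Λ
  have hnorm : eLpNorm g q volume ≤ ENNReal.ofReal ‖Λ‖ := by
    refine eLpNorm_le_of_norm_integral_mul_le hpq hp (ne_top_of_le_two hp2) hg (norm_nonneg _)
      fun h M hm hc hM => ?_
    have hh : MemLp h p volume :=
      hc.memLp_of_bound hm.aestronglyMeasurable M (Eventually.of_forall hM)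
    rw [← hΛ h hh (memLp_one_add_norm_pow_mul_of_hasCompactSupport hm hc hM k 2), ← Lp.norm_toLp]
    exact Λ.le_opNorm _
  have hgmem : MemLp g q volume := ⟨hg.aestronglyMeasurable, hnorm.trans_lt ENNReal.ofReal_lt_top⟩
  refine ⟨hgmem.toLp, ?_, fun φ => ?_⟩
  · rw [Lp.norm_toLp]
    exact ENNReal.toReal_le_of_le_ofReal (norm_nonneg _) hnorm
  · rw [SchwartzMap.toLp, hΛ φ (φ.memLp p volume) (memLp_one_add_norm_pow_mul_schwartz φ k 2)]
    refine integral_congr_ae ?_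
    filter_upwards [hgmem.coeFn_toLp] with x hx
    rw [hx]

end Duality

section PolarCoordinates

variable {V : Type*} [NormedAddCommGroup V] [NormedSpace ℝ V] [FiniteDimensional ℝ V]
  [Nontrivial V] [MeasurableSpace V] [BorelSpace V] {F : V → ℝ≥0∞}

theorem lintegral_eq_lintegral_Ioi_lintegral_toSphere (μ : Measure V) [μ.IsAddHaarMeasure]
    (hF : Measurable F) :
    ∫⁻ ξ, F ξ ∂μ = ∫⁻ r in Ioi (0 : ℝ), ENNReal.ofReal (r ^ (Module.finrank ℝ V - 1)) *
      ∫⁻ θ, F (r • (θ : V)) ∂μ.toSphere := by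
  have hFm : Measurable fun z : Metric.sphere (0 : V) 1 × Ioi (0 : ℝ) =>
      F ((z.2 : ℝ) • (z.1 : V)) := by fun_prop
  calc ∫⁻ ξ, F ξ ∂μ = ∫⁻ ξ : ({0}ᶜ : Set V), F ξ ∂(μ.comap Subtype.val) := by
        rw [lintegral_subtype_comap (measurableSet_singleton _).compl, restrict_compl_singleton]
    _ = ∫⁻ z, F ((z.2 : ℝ) • (z.1 : V))
          ∂(μ.toSphere.prod (Measure.volumeIoiPow (Module.finrank ℝ V - 1))) := by
        rw [← μ.measurePreserving_homeomorphUnitSphereProd.lintegral_comp_emb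
          (Homeomorph.measurableEmbedding _)]
        refine lintegral_congr fun ξ => ?_
        have hξ : ‖(ξ : V)‖ ≠ 0 := norm_ne_zero_iff.2 ξ.2
        simp [smul_smul, hξ]
    _ = _ := by
        rw [lintegral_prod_symm' _ hFm, Measure.volumeIoiPow,
          lintegral_withDensity_eq_lintegral_mul _ (by fun_prop) hFm.lintegral_prod_left']
        exact lintegral_subtype_comap measurableSet_Ioi fun r : ℝ =>
          ENNReal.ofReal (r ^ (Module.finrank ℝ V - 1)) * ∫⁻ θ, F (r • (θ : V)) ∂μ.toSphere

theorem lintegral_Ioi_lintegral_toSphere (μ : Measure V) [μ.IsAddHaarMeasure]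
    (hF : Measurable F) :
    ∫⁻ r in Ioi (0 : ℝ), ∫⁻ θ, F (r • (θ : V)) ∂μ.toSphere =
      ∫⁻ ξ, F ξ * ENNReal.ofReal (‖ξ‖ ^ (-((Module.finrank ℝ V : ℝ) - 1))) ∂μ := by
  rw [lintegral_eq_lintegral_Ioi_lintegral_toSphere μ (by fun_prop)]
  refine setLIntegral_congr_fun measurableSet_Ioi fun r (hr : 0 < r) => ?_
  have hnorm (θ : Metric.sphere (0 : V) 1) : ‖r • (θ : V)‖ = r := by simp [norm_smul, hr.le]
  simp only [hnorm]
  rw [lintegral_mul_const' _ _ ENNReal.ofReal_ne_top, mul_left_comm,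
    ← ENNReal.ofReal_mul (by positivity), ← Real.rpow_natCast,
    Nat.cast_sub Module.finrank_pos, Nat.cast_one, ← Real.rpow_add hr, add_neg_cancel,
    Real.rpow_zero, ENNReal.ofReal_one, mul_one]

theorem lintegral_lintegral_toSphere (μ : Measure V) [μ.IsAddHaarMeasure] (hF : Measurable F) :
    ∫⁻ r : ℝ, ∫⁻ θ, F (r • (θ : V)) ∂μ.toSphere =
      2 * ∫⁻ ξ, F ξ * ENNReal.ofReal (‖ξ‖ ^ (-((Module.finrank ℝ V : ℝ) - 1))) ∂μ := by
  have hneg : ∫⁻ r in Iio (0 : ℝ), ∫⁻ θ, F (r • (θ : V)) ∂μ.toSphere =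
      ∫⁻ r in Ioi (0 : ℝ), ∫⁻ θ, F (-(r • (θ : V))) ∂μ.toSphere := by
    rw [← (Measure.measurePreserving_neg (volume : Measure ℝ)).setLIntegral_comp_preimage_emb
      (MeasurableEquiv.neg ℝ).measurableEmbedding]
    simp
  rw [← lintegral_add_compl _ (measurableSet_Ioi (a := (0 : ℝ))), compl_Ioi,
    setLIntegral_congr Iio_ae_eq_Iic.symm, hneg, lintegral_Ioi_lintegral_toSphere μ hF,
    lintegral_Ioi_lintegral_toSphere μ (F := fun ξ => F (-ξ)) (by fun_prop), two_mul]
  congr 1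
  rw [← (Measure.measurePreserving_neg μ).lintegral_comp_emb
    (MeasurableEquiv.neg V).measurableEmbedding]
  simp

end PolarCoordinates

section PolarMeasure

variable {n : ℕ} {q : ℝ≥0∞}

instance : IsFiniteMeasure (sphereMeasure n) := by unfold sphereMeasure; infer_instance

instance : SigmaFinite (cylinderMeasure n) := by unfold cylinderMeasure; infer_instance

theorem nontrivial_E (hn : 1 ≤ n) : Nontrivial (E n) :=
  Module.nontrivial_of_finrank_pos (R := ℝ) (by rwa [finrank_euclideanSpace_fin])

/-- The map `(τ, θ) ↦ τ θ` from the cylinder to `ℝⁿ`. -/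
def polarMap (z : ℝ × Sph n) : E n := z.1 • (z.2 : E n)

theorem continuous_polarMap : Continuous (polarMap (n := n)) := by
  unfold polarMap; fun_prop

theorem norm_polarMap (z : ℝ × Sph n) : ‖polarMap z‖ = ‖z.1‖ := by
  simp [polarMap, norm_smul]

/-- The image of the measure `dτ dθ` under `(τ, θ) ↦ τ θ`. -/
noncomputable def polarMeasure (n : ℕ) : Measure (E n) := (cylinderMeasure n).map polarMap

theorem measurePreserving_polarMap :
    MeasurePreserving (polarMap (n := n)) (cylinderMeasure n) (polarMeasure n) :=
  ⟨continuous_polarMap.measurable, rfl⟩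

theorem lintegral_polarMeasure (hn : 1 ≤ n) {F : E n → ℝ≥0∞} (hF : Measurable F) :
    ∫⁻ ξ, F ξ ∂(polarMeasure n) = 2 * ∫⁻ ξ, F ξ * ENNReal.ofReal (‖ξ‖ ^ (-((n : ℝ) - 1))) := by
  have := nontrivial_E hn
  have hm : Measurable fun z : ℝ × Sph n => F (polarMap z) :=
    hF.comp continuous_polarMap.measurable
  rw [polarMeasure, lintegral_map hF continuous_polarMap.measurable, cylinderMeasure,
    lintegral_prod _ hm.aemeasurable]
  have h := lintegral_lintegral_toSphere (volume : Measure (E n)) hF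
  rwa [finrank_euclideanSpace_fin] at h

theorem polarMeasure_eq_withDensity (hn : 1 ≤ n) :
    polarMeasure n = (volume : Measure (E n)).withDensity
      fun ξ => ENNReal.ofReal (2 * ‖ξ‖ ^ (-((n : ℝ) - 1))) := by
  ext s hs
  rw [withDensity_apply _ hs, ← lintegral_indicator_one hs,
    lintegral_polarMeasure hn (measurable_one.indicator hs),
    ← lintegral_const_mul _ (by exact (measurable_one.indicator hs).mul (by fun_prop)),
    ← lintegral_indicator hs]
  refine lintegral_congr fun ξ => ?_
  by_cases h : ξ ∈ s <;> simp [h, ENNReal.ofReal_mul]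

theorem ae_polarMeasure_ne_zero (hn : 1 ≤ n) : ∀ᵐ ξ ∂(polarMeasure n), ξ ≠ 0 := by
  have := nontrivial_E hn
  rw [polarMeasure_eq_withDensity hn]
  exact (withDensity_absolutelyContinuous _ _).ae_le (Measure.ae_ne volume 0)

theorem eLpNorm_polarMeasure (hn : 1 ≤ n) (hq0 : q ≠ 0) (hq : q ≠ ∞) {F : E n → ℂ}
    (hF : Measurable F) :
    eLpNorm F q (polarMeasure n) = 2 ^ (1 / q.toReal) *
      eLpNorm (fun ξ => ((‖ξ‖ ^ (-((n : ℝ) - 1) / q.toReal) : ℝ) : ℂ) * F ξ) q volume := by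
  have hQ : 0 < q.toReal := ENNReal.toReal_pos hq0 hq
  simp_rw [eLpNorm_eq_lintegral_rpow_enorm_toReal hq0 hq]
  rw [lintegral_polarMeasure hn (by fun_prop), ENNReal.mul_rpow_of_nonneg _ _ (by positivity)]
  congr 3
  ext ξ
  rw [enorm_mul, ENNReal.mul_rpow_of_nonneg _ _ hQ.le, mul_comm,
    ← ofReal_norm ((‖ξ‖ ^ (-((n : ℝ) - 1) / q.toReal) : ℝ) : ℂ),
    Complex.norm_real, Real.norm_of_nonneg (by positivity),
    ENNReal.ofReal_rpow_of_nonneg (by positivity) hQ.le, ← Real.rpow_mul (norm_nonneg ξ),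
    div_mul_cancel₀ _ hQ.ne']

/-- The pullback of functions along `(τ, θ) ↦ τ θ`, as an isometry of `L^q` spaces. -/
noncomputable def polarIsometry (n : ℕ) (q : ℝ≥0∞) [Fact (1 ≤ q)] :
    Lp ℂ q (polarMeasure n) →ₗᵢ[ℂ] Lp ℂ q (cylinderMeasure n) :=
  Lp.compMeasurePreservingₗᵢ ℂ polarMap measurePreserving_polarMap

theorem coeFn_polarIsometry [Fact (1 ≤ q)] (H : Lp ℂ q (polarMeasure n)) :
    (polarIsometry n q H : ℝ × Sph n → ℂ) =ᵐ[cylinderMeasure n] H ∘ polarMap :=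
  Lp.coeFn_compMeasurePreserving H measurePreserving_polarMap

theorem coeFn_polarIsometry_of_ae_eq [Fact (1 ≤ q)] {H : Lp ℂ q (polarMeasure n)} {F : E n → ℂ}
    (h : H =ᵐ[polarMeasure n] F) :
    (polarIsometry n q H : ℝ × Sph n → ℂ) =ᵐ[cylinderMeasure n] F ∘ polarMap :=
  (coeFn_polarIsometry H).trans
    (measurePreserving_polarMap.quasiMeasurePreserving.ae_eq_comp h)

end PolarMeasure

section FourierSlice

variable {n : ℕ}

theorem measurePreserving_smul_add (θ : Sph n) :
    MeasurePreserving fun z : ℝ × (Submodule.span ℝ {(θ : E n)})ᗮ =>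
      z.1 • (θ : E n) + (z.2 : E n) := by
  set K := Submodule.span ℝ {(θ : E n)}
  have hθ : ‖(θ : E n)‖ = 1 := norm_eq_of_mem_sphere θ
  have hline : MeasurePreserving
      (LinearIsometryEquiv.toSpanUnitSingleton (𝕜 := ℝ) (θ : E n) hθ) :=
    LinearIsometryEquiv.measurePreserving _
  have hsum := K.orthogonalDecomposition.symm.measurePreserving.comp
    ((WithLp.volume_preserving_toLp K Kᗮ).comp
      (hline.prod (MeasurePreserving.id (volume : Measure Kᗮ))))
  convert hsum using 1
  · ext z
    simp
  · rfl

/-- Decompose `x = σ θ + y` with `y ⟂ θ` in the integral defining `𝓕 f (τ θ)`. -/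
theorem fourier_radon {f : E n → ℂ} (hf : Integrable f) (θ : Sph n) (τ : ℝ) :
    𝓕 (fun σ => radon f σ θ) τ = 𝓕 f (τ • (θ : E n)) := by
  have hmp := measurePreserving_smul_add θ
  set g : E n → ℂ := fun x => Real.fourierChar (-(inner ℝ x (τ • (θ : E n)))) • f x with hg
  have hgi : Integrable g := (Real.fourierIntegral_convergent_iff (τ • (θ : E n))).2 hf
  have hgc : Integrable fun z : ℝ × (Submodule.span ℝ {(θ : E n)})ᗮ =>
      g (z.1 • (θ : E n) + (z.2 : E n)) := hmp.integrable_comp_of_integrable hgi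
  rw [Real.fourier_eq, Real.fourier_eq, ← hg, ← hmp.map_eq,
    integral_map hmp.measurable.aemeasurable (hmp.map_eq ▸ hgi.aestronglyMeasurable),
    Measure.volume_eq_prod, integral_prod _ (by exact hgc)]
  refine integral_congr_ae (Eventually.of_forall fun σ => ?_)
  simp only [radon, Circle.smul_def]
  rw [OrthonormalBasis.addHaar_eq_volume, ← integral_smul]
  refine integral_congr_ae (Eventually.of_forall fun y => ?_)
  have hy : inner ℝ (y : E n) (θ : E n) = 0 :=
    Submodule.inner_left_of_mem_orthogonal (Submodule.mem_span_singleton_self _) y.2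
  simp [inner_add_left, inner_smul_left, inner_smul_right, hy]

theorem weightedFourier_radon {f : E n → ℂ} (hf : Integrable f) (s t : ℝ) :
    weightedFourier s t (radon f) = (fun ξ => (vWeight s t ξ : ℂ) * 𝓕 f ξ) ∘ polarMap := by
  ext z
  rw [weightedFourier, fourier_radon hf, Function.comp_apply, vWeight, vWeight, norm_polarMap]
  rfl

theorem measurable_vWeight {V : Type*} [NormedAddCommGroup V] [MeasurableSpace V]
    [OpensMeasurableSpace V] (s t : ℝ) : Measurable (vWeight s t : V → ℝ) := by
  unfold vWeight; fun_prop

theorem measurable_vWeight_mul_fourier (s t : ℝ) {f : E n → ℂ} (hf : Integrable f) :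
    Measurable fun ξ => (vWeight s t ξ : ℂ) * 𝓕 f ξ :=
  (Complex.measurable_ofReal.comp (measurable_vWeight s t)).mul
    (continuous_fourier_of_integrable hf).measurable

theorem sinogramNorm_eq_eLpNorm_weightedFourier {p : ℝ≥0∞} (hp0 : p ≠ 0) (hp : p ≠ ∞) {s t : ℝ}
    {g : ℝ → Sph n → ℂ} (hg : Measurable (weightedFourier s t g)) :
    sinogramNorm s t p g = eLpNorm (weightedFourier s t g) p (cylinderMeasure n) := by
  have hP : 0 < p.toReal := ENNReal.toReal_pos hp0 hp
  rw [eLpNorm_eq_lintegral_rpow_enorm_toReal hp0 hp, sinogramNorm, cylinderMeasure,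
    lintegral_prod_symm' _ (hg.enorm.pow_const p.toReal)]
  congr 1
  refine lintegral_congr fun θ => ?_
  rw [sNorm, eLpNorm_eq_lintegral_rpow_enorm_toReal hp0 hp, ← ENNReal.rpow_mul,
    one_div_mul_cancel hP.ne', ENNReal.rpow_one]
  rfl

theorem sinogramNorm_radon {f : E n → ℂ} (hf : Integrable f) (s t : ℝ) {p : ℝ≥0∞} (hp0 : p ≠ 0)
    (hp : p ≠ ∞) : sinogramNorm s t p (radon f) =
      eLpNorm (fun ξ => (vWeight s t ξ : ℂ) * 𝓕 f ξ) p (polarMeasure n) := by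
  have hm := measurable_vWeight_mul_fourier s t hf
  have hcomp := weightedFourier_radon hf s t
  rw [sinogramNorm_eq_eLpNorm_weightedFourier hp0 hp, hcomp,
    eLpNorm_comp_measurePreserving hm.aestronglyMeasurable measurePreserving_polarMap]
  exact hcomp ▸ hm.comp continuous_polarMap.measurable

end FourierSlice

section IndicatorSpan

variable {X : Type*} [MeasurableSpace X] {μ : Measure X} {p : ℝ≥0∞}
  {W : Submodule ℂ (Lp ℂ p μ)}

theorem indicatorConstLp_sdiff_mem {s t : Set X} (hs : MeasurableSet s) (ht : MeasurableSet t)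
    (hμs : μ s ≠ ∞) (hμt : μ t ≠ ∞) (hst : s ⊆ t) (h_s : indicatorConstLp p hs hμs (1 : ℂ) ∈ W)
    (h_t : indicatorConstLp p ht hμt (1 : ℂ) ∈ W) :
    indicatorConstLp p (ht.diff hs) (measure_ne_top_of_subset sdiff_subset hμt) (1 : ℂ) ∈ W := by
  have h := indicatorConstLp_disjoint_union (p := p) hs (ht.diff hs) hμs
    (measure_ne_top_of_subset sdiff_subset hμt) disjoint_sdiff_right (1 : ℂ)
  simp only [union_sdiff_cancel hst] at h
  rw [← sub_eq_iff_eq_add'.2 h]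
  exact W.sub_mem h_t h_s

variable [Fact (1 ≤ p)]

theorem indicatorConstLp_iUnion_mem_of_monotone (hp : p ≠ ∞) (hW : IsClosed (W : Set (Lp ℂ p μ)))
    {t : ℕ → Set X} (ht : ∀ i, MeasurableSet (t i)) (hμ : μ (⋃ i, t i) ≠ ∞) (hmono : Monotone t)
    (h : ∀ i (hμt : μ (t i) ≠ ∞), indicatorConstLp p (ht i) hμt (1 : ℂ) ∈ W) :
    indicatorConstLp p (MeasurableSet.iUnion ht) hμ (1 : ℂ) ∈ W := by
  have hμt (i : ℕ) : μ (t i) ≠ ∞ := measure_ne_top_of_subset (subset_iUnion t i) hμ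
  refine hW.mem_of_tendsto (b := atTop) (tendsto_indicatorConstLp_set (hμt := hμt) hp ?_)
    (Eventually.of_forall fun i => h i (hμt i))
  simp_rw [symmDiff_of_le (subset_iUnion t _)]
  have hlim := tendsto_measure_iInter_atTop (μ := μ) (s := fun i => (⋃ j, t j) \ t i)
    (fun i => ((MeasurableSet.iUnion ht).diff (ht i)).nullMeasurableSet)
    (fun i j hij => sdiff_subset_sdiff_right (hmono hij))
    ⟨0, measure_ne_top_of_subset sdiff_subset hμ⟩
  rwa [← sdiff_iUnion, Set.sdiff_self, measure_empty] at hlim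

theorem indicatorConstLp_iUnion_mem_of_disjoint (hp : p ≠ ∞) (hW : IsClosed (W : Set (Lp ℂ p μ)))
    {t : ℕ → Set X} (ht : ∀ i, MeasurableSet (t i)) (hμ : μ (⋃ i, t i) ≠ ∞)
    (hdisj : Pairwise (Function.onFun Disjoint t))
    (h : ∀ i (hμt : μ (t i) ≠ ∞), indicatorConstLp p (ht i) hμt (1 : ℂ) ∈ W) :
    indicatorConstLp p (MeasurableSet.iUnion ht) hμ (1 : ℂ) ∈ W := by
  have hacc (i : ℕ) : MeasurableSet (accumulate t i) := 
    MeasurableSet.biUnion (to_countable _) fun j _ => ht j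
  have key := indicatorConstLp_iUnion_mem_of_monotone hp hW (t := accumulate t) hacc
    (by rwa [iUnion_accumulate]) monotone_accumulate fun i hμi => ?_
  · simpa only [iUnion_accumulate] using key
  induction i with
  | zero => simpa only [accumulate_zero_nat] using h 0 (by simpa using hμi)
  | succ i ih =>
    have hμ1 := measure_ne_top_of_subset (subset_accumulate.trans subset_rfl) hμi
    have hμ2 := measure_ne_top_of_subset (monotone_accumulate (Nat.le_succ i)) hμi
    have hadd := indicatorConstLp_disjoint_union (p := p) (hacc i) (ht (i + 1)) hμ2 hμ1
      (disjoint_accumulate hdisj (Nat.lt_succ_self i)) (1 : ℂ)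
    simp only [accumulate_succ]
    rw [hadd]
    exact W.add_mem (ih hμ2) (h _ hμ1)

theorem indicatorConstLp_inter_mem_of_isPiSystem (hp : p ≠ ∞) (hW : IsClosed (W : Set (Lp ℂ p μ)))
    {C : Set (Set X)} (hC : ‹MeasurableSpace X› = MeasurableSpace.generateFrom C)
    (hC_inter : IsPiSystem C) {D : Set X} (hD : MeasurableSet D) (hμD : μ D ≠ ∞)
    (hDW : indicatorConstLp p hD hμD (1 : ℂ) ∈ W)
    (h : ∀ s ∈ C, ∀ (hs : MeasurableSet (s ∩ D)) (hμs : μ (s ∩ D) ≠ ∞),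
      indicatorConstLp p hs hμs (1 : ℂ) ∈ W)
    {s : Set X} (hs : MeasurableSet s) (hμs : μ (s ∩ D) ≠ ∞) :
    indicatorConstLp p (hs.inter hD) hμs (1 : ℂ) ∈ W := by
  have hfin (s : Set X) : μ (s ∩ D) ≠ ∞ := measure_ne_top_of_subset inter_subset_right hμD
  induction s, hs using MeasurableSpace.induction_on_inter hC hC_inter with
  | empty => simp
  | basic s hs => exact h s hs _ _
  | compl s hs ih =>
    have hcompl : sᶜ ∩ D = D \ (s ∩ D) := by rw [inter_comm, ← sdiff_eq, sdiff_inter_self_eq_sdiff]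
    simpa only [hcompl] using
      indicatorConstLp_sdiff_mem (hs.inter hD) hD (hfin s) hμD inter_subset_right (ih _) hDW
  | iUnion t hdisj ht ih =>
    have key := indicatorConstLp_iUnion_mem_of_disjoint hp hW (fun i => (ht i).inter hD)
      (by rw [← iUnion_inter]; exact hfin _)
      (fun i j hij => (hdisj hij).mono inter_subset_left inter_subset_left) ih
    simpa only [← iUnion_inter] using key

theorem eq_top_of_forall_indicatorConstLp_mem (hp : p ≠ ∞) (hW : IsClosed (W : Set (Lp ℂ p μ)))
    (h : ∀ (s : Set X) (hs : MeasurableSet s) (hμs : μ s ≠ ∞),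
      indicatorConstLp p hs hμs (1 : ℂ) ∈ W) : W = ⊤ := by
  refine eq_top_iff.2 fun f _ => Lp.induction hp (motive := fun f => f ∈ W)
    (fun c s hs hμs => ?_) (fun _ _ _ _ _ => W.add_mem) hW f
  have hsmul : indicatorConstLp p hs hμs.ne c = c • indicatorConstLp p hs hμs.ne (1 : ℂ) := by
    rw [indicatorConstLp, indicatorConstLp, ← MemLp.toLp_const_smul]
    congr 1
    ext x
    by_cases hx : x ∈ s <;> simp [hx]
  rw [Lp.simpleFunc.coe_indicatorConst, hsmul]
  exact W.smul_mem c (h s hs hμs.ne)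

end IndicatorSpan

section ProductDensity

variable {X Y : Type*} [MeasurableSpace X] [MeasurableSpace Y] {μ : Measure X} {ν : Measure Y}
  {p : ℝ≥0∞}

theorem eq_top_of_indicatorConstLp_prod_mem [SigmaFinite μ] [SigmaFinite ν] [Fact (1 ≤ p)]
    (hp : p ≠ ∞) {W : Submodule ℂ (Lp ℂ p (μ.prod ν))}
    (hW : IsClosed (W : Set (Lp ℂ p (μ.prod ν))))
    (h : ∀ (A : Set X) (B : Set Y) (hA : MeasurableSet A) (hB : MeasurableSet B), μ A ≠ ∞ →
      ν B ≠ ∞ → ∀ hAB : μ.prod ν (A ×ˢ B) ≠ ∞,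
        indicatorConstLp p (hA.prod hB) hAB (1 : ℂ) ∈ W) : W = ⊤ := by
  set D : ℕ → Set (X × Y) := fun N => spanningSets μ N ×ˢ spanningSets ν N with hD
  have hDm (N : ℕ) : MeasurableSet (D N) :=
    (measurableSet_spanningSets μ N).prod (measurableSet_spanningSets ν N)
  have hμN (N : ℕ) : μ (spanningSets μ N) ≠ ∞ := (measure_spanningSets_lt_top μ N).ne
  have hνN (N : ℕ) : ν (spanningSets ν N) ≠ ∞ := (measure_spanningSets_lt_top ν N).ne
  have hDfin (N : ℕ) : μ.prod ν (D N) ≠ ∞ := by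
    rw [hD, Measure.prod_prod]
    exact ENNReal.mul_ne_top (hμN N) (hνN N)
  have hDunion : ⋃ N, D N = univ := by
    rw [hD, iUnion_prod_of_monotone (monotone_spanningSets μ) (monotone_spanningSets ν),
      iUnion_spanningSets, iUnion_spanningSets, univ_prod_univ]
  have hDmono : Monotone D := fun i j hij =>
    prod_mono (monotone_spanningSets μ hij) (monotone_spanningSets ν hij)
  refine eq_top_of_forall_indicatorConstLp_mem hp hW fun s hs hμs => ?_
  have key := indicatorConstLp_iUnion_mem_of_monotone hp hW (fun N => hs.inter (hDm N))
    (by rwa [← inter_iUnion, hDunion, inter_univ])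
    (fun i j hij => inter_subset_inter_right s (hDmono hij)) fun N hμN' => ?_
  · simpa only [← inter_iUnion, hDunion, inter_univ] using key
  refine indicatorConstLp_inter_mem_of_isPiSystem hp hW generateFrom_prod.symm isPiSystem_prod
    (hDm N) (hDfin N) (h _ _ (measurableSet_spanningSets μ N) (measurableSet_spanningSets ν N)
      (hμN N) (hνN N) _) ?_ hs hμN'
  rintro _ ⟨A, hA, B, hB, rfl⟩
  simp only [hD, prod_inter_prod]
  exact fun _ hμ => h _ _ (hA.inter (measurableSet_spanningSets μ N))
    (hB.inter (measurableSet_spanningSets ν N))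
    (measure_ne_top_of_subset inter_subset_right (hμN N))
    (measure_ne_top_of_subset inter_subset_right (hνN N)) hμ

theorem eLpNorm_prod_mul [SFinite ν] (hp0 : p ≠ 0) (hp : p ≠ ∞) {f : X → ℂ} {g : Y → ℂ}
    (hf : AEStronglyMeasurable f μ) (hg : AEStronglyMeasurable g ν) :
    eLpNorm (fun z : X × Y => f z.1 * g z.2) p (μ.prod ν) = eLpNorm f p μ * eLpNorm g p ν := by
  have h0 : 0 < p.toReal := ENNReal.toReal_pos hp0 hp
  simp_rw [eLpNorm_eq_lintegral_rpow_enorm_toReal hp0 hp, enorm_mul,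
    ENNReal.mul_rpow_of_nonneg _ _ h0.le]
  rw [lintegral_prod_mul (hf.enorm.pow_const _) (hg.enorm.pow_const _),
    ENNReal.mul_rpow_of_nonneg _ _ (by positivity)]

theorem memLp_prod_mul [SFinite ν] (hp0 : p ≠ 0) (hp : p ≠ ∞) {f : X → ℂ} {g : Y → ℂ}
    (hf : MemLp f p μ) (hg : MemLp g p ν) :
    MemLp (fun z : X × Y => f z.1 * g z.2) p (μ.prod ν) :=
  ⟨hf.1.comp_fst.mul hg.1.comp_snd, by
    rw [eLpNorm_prod_mul hp0 hp hf.1 hg.1]; exact ENNReal.mul_lt_top hf.2 hg.2⟩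

/-- The bilinear map `(f, g) ↦ ((x, y) ↦ f x * g y)` on `L^p` spaces. -/
noncomputable def prodMulLp [SFinite ν] [Fact (1 ≤ p)] (hp : p ≠ ∞) :
    Lp ℂ p μ →L[ℂ] Lp ℂ p ν →L[ℂ] Lp ℂ p (μ.prod ν) :=
  have hp0 : p ≠ 0 := (one_pos.trans_le Fact.out).ne'
  have hmul (f : Lp ℂ p μ) (g : Lp ℂ p ν) := memLp_prod_mul hp0 hp (Lp.memLp f) (Lp.memLp g)
  have hfst {f f' : X → ℂ} (h : f =ᵐ[μ] f') :=
    (Measure.quasiMeasurePreserving_fst (ν := ν)).ae_eq_comp h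
  have hsnd {g g' : Y → ℂ} (h : g =ᵐ[ν] g') :=
    (Measure.quasiMeasurePreserving_snd (μ := μ)).ae_eq_comp h
  LinearMap.mkContinuous₂
    (LinearMap.mk₂ ℂ (fun f g => (hmul f g).toLp)
      (fun f f' g => by
        rw [← MemLp.toLp_add]
        refine MemLp.toLp_congr _ _ ?_
        filter_upwards [hfst (Lp.coeFn_add f f')] with z hz
        simp_all [add_mul])
      (fun c f g => by
        rw [← MemLp.toLp_const_smul]
        refine MemLp.toLp_congr _ _ ?_
        filter_upwards [hfst (Lp.coeFn_smul c f)] with z hz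
        simp_all [mul_assoc])
      (fun f g g' => by
        rw [← MemLp.toLp_add]
        refine MemLp.toLp_congr _ _ ?_
        filter_upwards [hsnd (Lp.coeFn_add g g')] with z hz
        simp_all [mul_add])
      (fun c f g => by
        rw [← MemLp.toLp_const_smul]
        refine MemLp.toLp_congr _ _ ?_
        filter_upwards [hsnd (Lp.coeFn_smul c g)] with z hz
        simp_all [mul_left_comm])) 1
    (fun f g => by
      rw [one_mul, LinearMap.mk₂_apply, Lp.norm_toLp, eLpNorm_prod_mul hp0 hp
        (Lp.aestronglyMeasurable f) (Lp.aestronglyMeasurable g), ENNReal.toReal_mul, Lp.norm_def,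
        Lp.norm_def])

theorem coeFn_prodMulLp [SFinite ν] [Fact (1 ≤ p)] (hp : p ≠ ∞) (f : Lp ℂ p μ) (g : Lp ℂ p ν) :
    prodMulLp hp f g =ᵐ[μ.prod ν] fun z => f z.1 * g z.2 :=
  (memLp_prod_mul (one_pos.trans_le Fact.out).ne' hp (Lp.memLp f) (Lp.memLp g)).coeFn_toLp

theorem eq_top_of_dense_prod_mul_mem [SigmaFinite μ] [SigmaFinite ν] [Fact (1 ≤ p)] (hp : p ≠ ∞)
    {m : Measure (X × Y)} (hm : m = μ.prod ν) {W : Submodule ℂ (Lp ℂ p m)}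
    (hW : IsClosed (W : Set (Lp ℂ p m))) {D₁ : Set (Lp ℂ p μ)} {D₂ : Set (Lp ℂ p ν)}
    (hD₁ : Dense D₁) (hD₂ : Dense D₂)
    (h : ∀ f ∈ D₁, ∀ g ∈ D₂, ∀ F : Lp ℂ p m, F =ᵐ[m] (fun z => f z.1 * g z.2) → F ∈ W) :
    W = ⊤ := by
  subst hm
  have hall (f : Lp ℂ p μ) (g : Lp ℂ p ν) : prodMulLp hp f g ∈ W := by
    rw [← SetLike.mem_coe, ← hW.closure_eq]
    exact map_mem_closure₂ (f := fun f g => prodMulLp hp f g) (prodMulLp hp).continuous₂ (hD₁ f)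
      (hD₂ g) fun f hf g hg => h f hf g hg _ (coeFn_prodMulLp hp f g)
  refine eq_top_of_indicatorConstLp_prod_mem hp hW fun A B hA hB hμA hνB hAB => ?_
  convert hall (indicatorConstLp p hA hμA 1) (indicatorConstLp p hB hνB 1) using 1
  refine Lp.ext (indicatorConstLp_coeFn.trans (EventuallyEq.trans ?_ (coeFn_prodMulLp hp _ _).symm))
  filter_upwards [Measure.quasiMeasurePreserving_fst.ae_eq_comp
      (indicatorConstLp_coeFn (p := p) (hs := hA) (hμs := hμA) (c := (1 : ℂ))),
    Measure.quasiMeasurePreserving_snd.ae_eq_comp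
      (indicatorConstLp_coeFn (p := p) (hs := hB) (hμs := hνB) (c := (1 : ℂ)))] with z hzA hzB
  simp only [Function.comp_apply] at hzA hzB
  rw [hzA, hzB]
  by_cases h₁ : z.1 ∈ A <;> by_cases h₂ : z.2 ∈ B <;> simp [h₁, h₂]

end ProductDensity

section WeightedDensity

variable {V : Type*} [NormedAddCommGroup V] [NormedSpace ℝ V] [FiniteDimensional ℝ V]
  [MeasurableSpace V] [BorelSpace V] {p : ℝ≥0∞}

theorem dense_of_forall_exists_eLpNorm_sub_le {X F : Type*} [MeasurableSpace X] {μ : Measure X}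
    [NormedAddCommGroup F] [Fact (1 ≤ p)] {D : Set (Lp F p μ)}
    (h : ∀ f : X → F, MemLp f p μ → ∀ ε : ℝ, 0 < ε → ∃ (g : X → F) (hg : MemLp g p μ),
      hg.toLp ∈ D ∧ eLpNorm (f - g) p μ ≤ ENNReal.ofReal ε) : Dense D := by
  intro f
  refine (mem_closure_iff_nhds_basis Metric.nhds_basis_closedBall).2 fun ε hε => ?_
  obtain ⟨g, hg, hgD, hfg⟩ := h f (Lp.memLp f) ε hε
  refine ⟨hg.toLp, hgD, ?_⟩
  rw [Metric.mem_closedBall', Lp.dist_def]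
  refine ENNReal.toReal_le_of_le_ofReal hε.le (le_of_eq_of_le (eLpNorm_congr_ae ?_) hfg)
  filter_upwards [hg.coeFn_toLp] with x hx
  rw [Pi.sub_apply, Pi.sub_apply, hx]

theorem eLpNorm_withDensity_nnnorm_rpow {X : Type*} [MeasurableSpace X] (μ : Measure X)
    (hp0 : p ≠ 0) (hp : p ≠ ∞) {w : X → ℂ} (hw : Measurable w) (f : X → ℂ) :
    eLpNorm f p (μ.withDensity fun x => ((‖w x‖₊ ^ p.toReal : ℝ≥0) : ℝ≥0∞)) =
      eLpNorm (fun x => w x * f x) p μ := by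
  have h0 : 0 < p.toReal := ENNReal.toReal_pos hp0 hp
  simp_rw [eLpNorm_eq_lintegral_rpow_enorm_toReal hp0 hp]
  rw [lintegral_withDensity_eq_lintegral_mul_non_measurable _ (by fun_prop)
    (Eventually.of_forall fun _ => ENNReal.coe_lt_top)]
  congr 1
  refine lintegral_congr fun x => ?_
  rw [Pi.mul_apply, enorm_mul, ENNReal.mul_rpow_of_nonneg _ _ h0.le, enorm_eq_nnnorm (w x),
    ENNReal.coe_rpow_of_nonneg _ h0.le]

theorem dense_mul_schwartz [Fact (1 ≤ p)] (hp : p ≠ ∞) (μ : Measure V) [IsLocallyFiniteMeasure μ]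
    {w : V → ℂ} (hw : Continuous w) (hw0 : ∀ᵐ x ∂μ, w x ≠ 0) :
    Dense {f : Lp ℂ p μ | ∃ φ : 𝓢(V, ℂ), f =ᵐ[μ] fun x => w x * φ x} := by
  have hp0 : p ≠ 0 := (one_pos.trans_le Fact.out).ne'
  refine dense_of_forall_exists_eLpNorm_sub_le fun f hf ε hε => ?_
  -- Approximating `f` by `w φ` in `L^p(μ)` is approximating `f / w` by `φ` in `L^p(|w|^p μ)`.
  set ρ : Measure V := μ.withDensity fun x => ((‖w x‖₊ ^ p.toReal : ℝ≥0) : ℝ≥0∞) with hρ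
  have : IsLocallyFiniteMeasure ρ := IsLocallyFiniteMeasure.withDensity_coe
    ((NNReal.continuous_rpow_const ENNReal.toReal_nonneg).comp hw.nnnorm)
  have hcancel : (fun x => w x * (f x / w x)) =ᵐ[μ] f := by
    filter_upwards [hw0] with x hx using mul_div_cancel₀ (f x) hx
  have hdiv : MemLp (fun x => f x / w x) p ρ := by
    refine ⟨(hf.1.div₀ hw.aestronglyMeasurable).mono_ac (withDensity_absolutelyContinuous _ _), ?_⟩
    rw [hρ, eLpNorm_withDensity_nnnorm_rpow μ hp0 hp hw.measurable, eLpNorm_congr_ae hcancel]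
    exact hf.2
  obtain ⟨φ, hφc, hφs, hφ⟩ := hdiv.exist_eLpNorm_sub_le hp Fact.out hε
  have hwφ : MemLp (fun x => w x * φ x) p μ :=
    (hw.mul hφs.continuous).memLp_of_hasCompactSupport hφc.mul_left
  refine ⟨_, hwφ, ⟨hφc.toSchwartzMap hφs, hwφ.coeFn_toLp⟩, le_of_eq_of_le ?_ hφ⟩
  rw [hρ, eLpNorm_withDensity_nnnorm_rpow μ hp0 hp hw.measurable]
  refine eLpNorm_congr_ae ?_
  filter_upwards [hcancel] with x hx
  rw [Pi.sub_apply, Pi.sub_apply, mul_sub, hx]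

theorem dense_schwartz_restrict [Fact (1 ≤ p)] (hp : p ≠ ∞) {S : Set V} (hS : MeasurableSet S)
    (ν : Measure S) [IsFiniteMeasure ν] :
    Dense {g : Lp ℂ p ν | ∃ b : 𝓢(V, ℂ), g =ᵐ[ν] fun x => b x} := by
  refine dense_of_forall_exists_eLpNorm_sub_le fun f hf ε hε => ?_
  have hemb : MeasurableEmbedding (Subtype.val : S → V) := .subtype_coe hS
  have : IsFiniteMeasure (ν.map Subtype.val) := Measure.isFiniteMeasure_map _ _
  have hext : Function.extend Subtype.val f 0 ∘ (Subtype.val : S → V) = f :=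
    Function.extend_comp Subtype.val_injective f 0
  obtain ⟨b, hbc, hbs, hb⟩ :=
    (hemb.memLp_map_measure_iff.2 (hext.symm ▸ hf)).exist_eLpNorm_sub_le hp Fact.out hε
  have hbν : MemLp (b ∘ (Subtype.val : S → V)) p ν := hemb.memLp_map_measure_iff.1
    (hbs.continuous.memLp_of_hasCompactSupport hbc)
  refine ⟨_, hbν, ⟨hbc.toSchwartzMap hbs, hbν.coeFn_toLp⟩, le_of_eq_of_le ?_ hb⟩
  rw [hemb.eLpNorm_map_measure, Pi.sub_comp, hext]

end WeightedDensity

section Tensor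

variable {V W : Type*} [NormedAddCommGroup V] [NormedSpace ℝ V] [NormedAddCommGroup W]
  [NormedSpace ℝ W]

theorem norm_iteratedFDeriv_comp_le_of_norm_le_one (f : 𝓢(W, ℂ)) {A : V →L[ℝ] W} (hA : ‖A‖ ≤ 1)
    (i : ℕ) (z : V) :
    ‖iteratedFDeriv ℝ i (fun z => f (A z)) z‖ ≤ ‖iteratedFDeriv ℝ i f (A z)‖ := by
  change ‖iteratedFDeriv ℝ i (f ∘ A) z‖ ≤ _
  rw [A.iteratedFDeriv_comp_right (f.smooth i) z le_rfl]
  refine (ContinuousMultilinearMap.norm_compContinuousLinearMap_le _ _).trans ?_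
  exact mul_le_of_le_one_right (norm_nonneg _)
    (Finset.prod_le_one (fun _ _ => norm_nonneg _) fun _ _ => hA)

theorem norm_iteratedFDeriv_prod_mul_le (f : 𝓢(V, ℂ)) (g : 𝓢(W, ℂ)) (m : ℕ) (z : V × W) :
    ‖iteratedFDeriv ℝ m (fun z : V × W => f z.1 * g z.2) z‖ ≤
      ∑ i ∈ Finset.range (m + 1), (m.choose i : ℝ) *
        (‖iteratedFDeriv ℝ i f z.1‖ * ‖iteratedFDeriv ℝ (m - i) g z.2‖) := by
  refine (norm_iteratedFDeriv_mul_le (N := (m : ℕ∞)) ((f.smooth m).comp contDiff_fst)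
    ((g.smooth m).comp contDiff_snd) z le_rfl).trans (Finset.sum_le_sum fun i _ => ?_)
  rw [mul_assoc]
  gcongr
  · exact norm_iteratedFDeriv_comp_le_of_norm_le_one f (ContinuousLinearMap.norm_fst_le ℝ V W) i z
  · exact norm_iteratedFDeriv_comp_le_of_norm_le_one g (ContinuousLinearMap.norm_snd_le ℝ V W) _ z

/-- The tensor product `(x, y) ↦ f x * g y` of two Schwartz functions. -/
noncomputable def schwartzTensor (f : 𝓢(V, ℂ)) (g : 𝓢(W, ℂ)) : 𝓢(V × W, ℂ) where
  toFun z := f z.1 * g z.2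
  smooth' := ((f.smooth _).comp contDiff_fst).mul ((g.smooth _).comp contDiff_snd)
  decay' k m := by
    let S := fun k i => SchwartzMap.seminorm ℝ (F := ℂ) (E := V) k i f
    let T := fun k i => SchwartzMap.seminorm ℝ (F := ℂ) (E := W) k i g
    refine ⟨∑ i ∈ Finset.range (m + 1), (m.choose i : ℝ) *
      (S k i * T 0 (m - i) + S 0 i * T k (m - i)), fun z => ?_⟩
    grw [norm_iteratedFDeriv_prod_mul_le f g m z, Finset.mul_sum]
    refine Finset.sum_le_sum fun i _ => ?_
    rw [mul_left_comm]
    gcongr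
    have hz : ‖z‖ ^ k ≤ ‖z.1‖ ^ k + ‖z.2‖ ^ k := by
      rw [Prod.norm_def]
      rcases max_choice ‖z.1‖ ‖z.2‖ with h | h <;> rw [h] <;> simp
    set a := ‖iteratedFDeriv ℝ i f z.1‖
    set b := ‖iteratedFDeriv ℝ (m - i) g z.2‖
    calc ‖z‖ ^ k * (a * b) ≤ (‖z.1‖ ^ k + ‖z.2‖ ^ k) * (a * b) := by gcongr
      _ = (‖z.1‖ ^ k * a) * (‖z.2‖ ^ 0 * b) + (‖z.1‖ ^ 0 * a) * (‖z.2‖ ^ k * b) := by ring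
      _ ≤ _ := by
          gcongr <;> first | exact apply_nonneg _ _ | exact SchwartzMap.le_seminorm ..

end Tensor

section SinogramDensity

variable {V : Type*} [NormedAddCommGroup V] {n : ℕ}

theorem continuous_vWeight (s : ℝ) {t : ℝ} (ht : 0 ≤ t) : Continuous (vWeight s t : V → ℝ) := by
  have hbase (a : ℝ) : Continuous fun x : V => (1 + ‖x‖ ^ 2) ^ a :=
    Continuous.rpow_const (by fun_prop) fun x => Or.inl (by positivity)
  exact (hbase _).mul (Continuous.rpow_const
    (continuous_norm.div (hbase _) fun x => by positivity) fun x => Or.inr ht)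

theorem vWeight_pos (s t : ℝ) {x : V} (hx : x ≠ 0) : 0 < vWeight s t x := by
  have := norm_pos_iff.2 hx
  unfold vWeight; positivity

theorem weightedFourier_fourierInv_mul (s t : ℝ) (φ : 𝓢(ℝ, ℂ)) (b : E n → ℂ) (z : ℝ × Sph n) :
    weightedFourier s t (fun σ θ => (𝓕⁻ φ : 𝓢(ℝ, ℂ)) σ * b θ) z =
      vWeight s t z.1 * φ z.1 * b z.2 := by
  have h : 𝓕 (fun σ => (𝓕⁻ φ : 𝓢(ℝ, ℂ)) σ * b z.2) z.1 =
      𝓕 ((𝓕⁻ φ : 𝓢(ℝ, ℂ)) : ℝ → ℂ) z.1 * b z.2 := by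
    rw [Real.fourier_eq, Real.fourier_eq, ← integral_mul_const]
    simp only [Circle.smul_def, smul_eq_mul, mul_assoc]
  rw [weightedFourier, h, ← SchwartzMap.fourier_coe, FourierTransform.fourier_fourierInv_eq,
    mul_assoc]

theorem sinogramSpace_eq_top (s : ℝ) {t : ℝ} (ht : 0 ≤ t) {p : ℝ≥0∞} [Fact (1 ≤ p)]
    (hp : p ≠ ∞) : SinogramSpace n s t p = ⊤ := by
  have hvc : Continuous fun τ : ℝ => (vWeight s t τ : ℂ) :=
    Complex.continuous_ofReal.comp (continuous_vWeight s ht)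
  have hv0 : ∀ᵐ τ : ℝ, (vWeight s t τ : ℂ) ≠ 0 := by
    filter_upwards [Measure.ae_ne volume 0] with τ hτ
    exact_mod_cast (vWeight_pos s t hτ).ne'
  refine eq_top_of_dense_prod_mul_mem (m := cylinderMeasure n) hp rfl
    (Submodule.isClosed_topologicalClosure _)
    (dense_mul_schwartz hp volume hvc hv0)
    (dense_schwartz_restrict hp Metric.isClosed_sphere.measurableSet (sphereMeasure n)) ?_
  rintro f ⟨φ, hφ⟩ g ⟨b, hb⟩ F hF
  refine Submodule.le_topologicalClosure _ (Submodule.subset_span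
    ⟨fun σ θ => (𝓕⁻ φ) σ * b θ, ⟨schwartzTensor (𝓕⁻ φ) b, fun _ _ => rfl⟩,
      hF.trans ?_⟩)
  filter_upwards [Measure.quasiMeasurePreserving_fst.ae_eq_comp hφ,
    Measure.quasiMeasurePreserving_snd.ae_eq_comp hb] with z hz₁ hz₂
  rw [weightedFourier_fourierInv_mul]
  exact congrArg₂ (· * ·) hz₁ hz₂

end SinogramDensity

section Extension

variable {V : Type*} [NormedAddCommGroup V] [NormedSpace ℝ V] [FiniteDimensional ℝ V]
  [MeasurableSpace V] [BorelSpace V]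

theorem locallyIntegrable_of_integrable_schwartz_mul {μ : Measure V} {f : V → ℂ}
    (h : ∀ ψ : 𝓢(V, ℂ), Integrable (fun x => ψ x * f x) μ) : LocallyIntegrable f μ := by
  intro x
  let b : ContDiffBump x := ⟨1, 2, one_pos, one_lt_two⟩
  have hcompact : HasCompactSupport (Complex.ofRealCLM ∘ b) := b.hasCompactSupport.comp_left rfl
  have hsmooth : ContDiff ℝ (⊤ : ℕ∞) (Complex.ofRealCLM ∘ b) :=
    Complex.ofRealCLM.contDiff.comp b.contDiff
  refine ⟨Metric.closedBall x 1, Metric.closedBall_mem_nhds x one_pos, ?_⟩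
  refine ((h (hcompact.toSchwartzMap hsmooth)).integrableOn (s := Metric.closedBall x 1)).congr_fun
    (fun y hy => ?_) Metric.isClosed_closedBall.measurableSet
  have : b y = 1 := b.one_of_mem_closedBall hy
  simp [this]

theorem exists_extension_of_eLpNorm_le {X : Type*} [MeasurableSpace X] {μ : Measure X}
    {ν : Measure V} [ν.HasTemperateGrowth] [IsFiniteMeasureOnCompacts ν] {p q : ℝ≥0∞}
    [Fact (1 ≤ p)] [Fact (1 ≤ q)] (hp : p ≠ ∞) (T : 𝓢(V, ℂ) →ₗ[ℂ] X → ℂ)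
    (hm : ∀ φ, AEStronglyMeasurable (T φ) μ) (C : ℝ≥0)
    (hT : ∀ φ, eLpNorm (T φ) q μ ≤ C * eLpNorm φ p ν) :
    ∃ U : Lp ℂ p ν →L[ℂ] Lp ℂ q μ, ∀ φ : 𝓢(V, ℂ), U (φ.toLp p ν) =ᵐ[μ] T φ := by
  have hmem (φ) : MemLp (T φ) q μ :=
    ⟨hm φ, (hT φ).trans_lt (ENNReal.mul_lt_top ENNReal.coe_lt_top (φ.memLp p ν).2)⟩
  let T' : 𝓢(V, ℂ) →ₗ[ℂ] Lp ℂ q μ :=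
    { toFun := fun φ => (hmem φ).toLp
      map_add' := fun φ ψ => by
        rw [← MemLp.toLp_add (hmem φ) (hmem ψ)]
        exact MemLp.toLp_congr _ _ (by rw [map_add])
      map_smul' := fun c φ => by
        rw [RingHom.id_apply, ← MemLp.toLp_const_smul c (hmem φ)]
        exact MemLp.toLp_congr _ _ (by rw [map_smul]) }
  let e : 𝓢(V, ℂ) →ₗ[ℂ] Lp ℂ p ν := (SchwartzMap.toLpCLM ℂ ℂ p ν).toLinearMap
  have hdense : DenseRange e := SchwartzMap.denseRange_toLpCLM hp
  have hbound (φ) : ‖T' φ‖ ≤ C * ‖e φ‖ := by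
    have h := ENNReal.toReal_mono
      (ENNReal.mul_ne_top ENNReal.coe_ne_top (φ.memLp p ν).2.ne) (hT φ)
    rw [ENNReal.toReal_mul, ENNReal.coe_toReal] at h
    exact ((Lp.norm_toLp _ (hmem φ)).trans_le h).trans_eq
      (congrArg ((C : ℝ) * ·) (Lp.norm_toLp _ (φ.memLp p ν)).symm)
  refine ⟨T'.extendOfNorm e, fun φ => ?_⟩
  exact (LinearMap.extendOfNorm_eq hdense ⟨C, hbound⟩ φ) ▸ (hmem φ).coeFn_toLp

end Extension

section PolarKernel

variable {n : ℕ} {p q : ℝ≥0∞} {t : ℝ}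

/-- The function `½ |ξ|^{n-1-t} 𝓕⁻¹φ(ξ)`. Since the polar measure is `2 |ξ|^{1-n} dξ`, its pairing
with `v_{s,t} 𝓕 f` in the polar measure is the pairing of `φ` with the Bessel potential of order
`s - t` of `f`. -/
noncomputable def polarKernel (n : ℕ) (t : ℝ) : 𝓢(E n, ℂ) →ₗ[ℂ] E n → ℂ where
  toFun φ ξ := ((1 / 2 * ‖ξ‖ ^ ((n : ℝ) - 1 - t) : ℝ) : ℂ) * 𝓕⁻ φ ξ
  map_add' φ ψ := by ext ξ; simp [FourierTransform.fourierInv_add, mul_add]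
  map_smul' c φ := by ext ξ; simp [FourierTransform.fourierInv_smul, mul_left_comm]

theorem polarKernel_apply (t : ℝ) (φ : 𝓢(E n, ℂ)) (ξ : E n) :
    polarKernel n t φ ξ = ((1 / 2 * ‖ξ‖ ^ ((n : ℝ) - 1 - t) : ℝ) : ℂ) * 𝓕⁻ φ ξ := rfl

theorem measurable_polarKernel (t : ℝ) (φ : 𝓢(E n, ℂ)) : Measurable (polarKernel n t φ) := by
  have h : Measurable fun ξ : E n => ((1 / 2 * ‖ξ‖ ^ ((n : ℝ) - 1 - t) : ℝ) : ℂ) :=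
    Complex.measurable_ofReal.comp (by fun_prop)
  exact h.mul (𝓕⁻ φ).continuous.measurable

theorem ae_eq_zero_of_integral_polarKernel_mul_eq_zero (hn : 1 ≤ n) {F : E n → ℂ}
    (hF : ∀ φ : 𝓢(E n, ℂ), Integrable (fun ξ => polarKernel n t φ ξ * F ξ) (polarMeasure n))
    (h0 : ∀ φ : 𝓢(E n, ℂ), ∫ ξ, polarKernel n t φ ξ * F ξ ∂(polarMeasure n) = 0) :
    ∀ᵐ ξ ∂(polarMeasure n), F ξ = 0 := by
  set w : E n → ℂ := fun ξ => ((1 / 2 * ‖ξ‖ ^ ((n : ℝ) - 1 - t) : ℝ) : ℂ)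
  have hkernel (ψ : 𝓢(E n, ℂ)) (ξ : E n) :
      polarKernel n t (𝓕 ψ) ξ * F ξ = ψ ξ * (w ξ * F ξ) := by
    rw [polarKernel_apply, FourierTransform.fourierInv_fourier_eq, mul_right_comm, mul_comm]
  have hlocal : LocallyIntegrable (fun ξ => w ξ * F ξ) (polarMeasure n) :=
    locallyIntegrable_of_integrable_schwartz_mul fun ψ => by simpa only [hkernel] using hF (𝓕 ψ)
  have hzero := ae_eq_zero_of_integral_schwartz_mul_eq_zero hlocal fun ψ => by
    simpa only [hkernel] using h0 (𝓕 ψ)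
  filter_upwards [hzero, ae_polarMeasure_ne_zero hn] with ξ hwF hξ
  have hξ0 : 0 < ‖ξ‖ := norm_pos_iff.2 hξ
  exact (mul_eq_zero.1 hwF).resolve_left (Complex.ofReal_ne_zero.2 (by positivity))

theorem norm_rpow_mul_polarKernel_le {P Q : ℝ} (hPQ : P.HolderConjugate Q)
    (ht : t = (n * Q - n - 1) / Q) (φ : 𝓢(E n, ℂ)) {ξ : E n} (hξ : ξ ≠ 0) :
    ‖((‖ξ‖ ^ (-((n : ℝ) - 1) / P) : ℝ) : ℂ) * polarKernel n t φ ξ‖ ≤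
      ‖((‖ξ‖ ^ (-(n * (2 / P - 1)) : ℝ) : ℝ) : ℂ) * 𝓕 (φ : E n → ℂ) (-ξ)‖ := by
  have hξ0 : 0 < ‖ξ‖ := norm_pos_iff.2 hξ
  have hexp : -((n : ℝ) - 1) / P + ((n : ℝ) - 1 - t) = -(n * (2 / P - 1)) := by
    have hQ : Q⁻¹ = 1 - P⁻¹ := by linarith [hPQ.inv_add_inv_eq_one]
    have ht' : t = n - (n + 1) * Q⁻¹ := by
      rw [ht]; field_simp [hPQ.symm.ne_zero]; ring
    rw [ht', hQ]; ring
  rw [polarKernel_apply, SchwartzMap.fourierInv_coe, Real.fourierInv_eq_fourier_neg, ← hexp,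
    Real.rpow_add hξ0]
  simp only [norm_mul, Complex.norm_real, Real.norm_of_nonneg (Real.rpow_nonneg hξ0.le _)]
  rw [← mul_assoc]
  gcongr
  norm_num
  exact mul_le_of_le_one_left (Real.rpow_nonneg hξ0.le _) (by norm_num)

theorem exists_eLpNorm_polarKernel_le (hn : 1 ≤ n) (hpq : p.HolderConjugate q) (hp : 1 < p)
    (hp2 : p ≤ 2) (ht : t = (n * q.toReal - n - 1) / q.toReal) :
    ∃ C : ℝ≥0, ∀ φ : 𝓢(E n, ℂ),
      eLpNorm (polarKernel n t φ) p (polarMeasure n) ≤ C * eLpNorm φ p volume := by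
  have := nontrivial_E hn
  have hp_top := ne_top_of_le_two hp2
  obtain ⟨C, hC⟩ := exists_eLpNorm_norm_rpow_mul_fourier_le (V := E n) hp hp2
  refine ⟨2 ^ (1 / p.toReal) * C, fun φ => ?_⟩
  simp only [finrank_euclideanSpace_fin] at hC
  set G : E n → ℂ := fun ξ =>
    ((‖ξ‖ ^ (-(n * (2 / p.toReal - 1)) : ℝ) : ℝ) : ℂ) * 𝓕 (φ : E n → ℂ) ξ with hG
  have hGm : Measurable G := (Complex.measurable_ofReal.comp (by fun_prop)).mul
    (continuous_fourier_of_integrable φ.integrable).measurable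
  rw [eLpNorm_polarMeasure hn hpq.ne_zero hp_top (measurable_polarKernel t φ), ENNReal.coe_mul,
    ENNReal.coe_rpow_of_nonneg _ (by positivity), ENNReal.coe_ofNat, mul_assoc]
  gcongr
  calc eLpNorm (fun ξ => ((‖ξ‖ ^ (-((n : ℝ) - 1) / p.toReal) : ℝ) : ℂ) * polarKernel n t φ ξ) p
        volume ≤ eLpNorm (G ∘ Neg.neg) p volume := by
        refine eLpNorm_mono_ae ?_
        filter_upwards [Measure.ae_ne (volume : Measure (E n)) 0] with ξ hξ
        simpa only [hG, Function.comp_apply, norm_neg] using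
          norm_rpow_mul_polarKernel_le (holderConjugate_toReal hpq hp hp_top) ht φ hξ
    _ = eLpNorm G p volume := eLpNorm_comp_measurePreserving hGm.aestronglyMeasurable
        (Measure.measurePreserving_neg _)
    _ ≤ _ := hC φ

theorem memLp_polarKernel (hn : 1 ≤ n) (hpq : p.HolderConjugate q) (hp : 1 < p) (hp2 : p ≤ 2)
    (ht : t = (n * q.toReal - n - 1) / q.toReal) (φ : 𝓢(E n, ℂ)) :
    MemLp (polarKernel n t φ) p (polarMeasure n) := by
  have : Fact (1 ≤ p) := ⟨hp.le⟩
  obtain ⟨C, hC⟩ := exists_eLpNorm_polarKernel_le hn hpq hp hp2 ht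
  exact ⟨(measurable_polarKernel t φ).aestronglyMeasurable,
    (hC φ).trans_lt (ENNReal.mul_lt_top ENNReal.coe_lt_top (φ.memLp p volume).2)⟩

end PolarKernel

section PolarDensity

variable {n : ℕ} {p q : ℝ≥0∞} [Fact (1 ≤ p)] [Fact (1 ≤ q)] {s t : ℝ} {u : 𝓢'(E n, ℂ)}
  {F F' : E n → ℂ}

/-- `F = v_{s,t} 𝓕 u` almost everywhere for the polar measure, stated weakly through the Bessel
potential of order `s - t` of `u` because `v_{s,t}` is not smooth at the origin. -/
def HasPolarDensity (s t : ℝ) (u : 𝓢'(E n, ℂ)) (F : E n → ℂ) : Prop :=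
  ∀ φ : 𝓢(E n, ℂ), Integrable (fun ξ => polarKernel n t φ ξ * F ξ) (polarMeasure n) ∧
    TemperedDistribution.besselPotential (E n) ℂ (s - t) u φ =
      ∫ ξ, polarKernel n t φ ξ * F ξ ∂(polarMeasure n)

theorem HasPolarDensity.congr_ae (h : HasPolarDensity s t u F) (hF : F =ᵐ[polarMeasure n] F') :
    HasPolarDensity s t u F' := fun φ => by
  have hmul : (fun ξ => polarKernel n t φ ξ * F ξ) =ᵐ[polarMeasure n]
      fun ξ => polarKernel n t φ ξ * F' ξ := by
    filter_upwards [hF] with ξ hξ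
    rw [hξ]
  exact ⟨(h φ).1.congr hmul, (h φ).2.trans (integral_congr_ae hmul)⟩

theorem HasPolarDensity.ae_eq (hn : 1 ≤ n) (h : HasPolarDensity s t u F)
    (h' : HasPolarDensity s t u F') : F =ᵐ[polarMeasure n] F' := by
  have hsub := ae_eq_zero_of_integral_polarKernel_mul_eq_zero hn (t := t) (F := F - F')
    (fun φ => by
      simp only [Pi.sub_apply, mul_sub]
      exact (h φ).1.sub (h' φ).1)
    (fun φ => by
      simp only [Pi.sub_apply, mul_sub]
      rw [integral_sub (h φ).1 (h' φ).1, ← (h φ).2, ← (h' φ).2, sub_self])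
  filter_upwards [hsub] with ξ hξ using sub_eq_zero.1 hξ

theorem vWeight_eq {V : Type*} [NormedAddCommGroup V] (s t : ℝ) (ξ : V) :
    vWeight s t ξ = (1 + ‖ξ‖ ^ 2) ^ ((s - t) / 2) * ‖ξ‖ ^ t := by
  have h : 0 < 1 + ‖ξ‖ ^ 2 := by positivity
  rw [vWeight, Real.div_rpow (norm_nonneg _) (by positivity), ← Real.rpow_mul h.le, sub_div,
    Real.rpow_sub h, one_div, inv_mul_eq_div]
  ring

theorem smul_polarKernel_mul_vWeight_mul (s t : ℝ) (φ : 𝓢(E n, ℂ)) {ξ : E n} (hξ : ξ ≠ 0) (z : ℂ) :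
    (2 * ‖ξ‖ ^ (-((n : ℝ) - 1))) • (polarKernel n t φ ξ * ((vWeight s t ξ : ℂ) * z)) =
      z * ((((1 + ‖ξ‖ ^ 2) ^ ((s - t) / 2) : ℝ) : ℂ) * 𝓕⁻ φ ξ) := by
  have hξ0 : 0 < ‖ξ‖ := norm_pos_iff.2 hξ
  have hpow : ((‖ξ‖ ^ (-((n : ℝ) - 1)) * (‖ξ‖ ^ ((n : ℝ) - 1 - t) * ‖ξ‖ ^ t) : ℝ) : ℂ) = 1 := by
    rw [← Real.rpow_add hξ0, ← Real.rpow_add hξ0, sub_add_cancel, neg_add_cancel, Real.rpow_zero,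
      Complex.ofReal_one]
  rw [polarKernel_apply, vWeight_eq, Complex.real_smul]
  push_cast at hpow ⊢
  linear_combination (𝓕⁻ φ ξ * z * (((1 + ‖ξ‖ ^ 2) ^ ((s - t) / 2) : ℝ) : ℂ)) * hpow

theorem besselPotential_toL1_apply (σ : ℝ) {f : E n → ℂ} (hf : Integrable f) (φ : 𝓢(E n, ℂ)) :
    TemperedDistribution.besselPotential (E n) ℂ σ (Lp.toTemperedDistribution (hf.toL1 f)) φ =
      ∫ ξ, 𝓕 f ξ * SchwartzMap.smulLeftCLM ℂ
        (fun x : E n => (((1 + ‖x‖ ^ 2) ^ (σ / 2) : ℝ) : ℂ)) (𝓕⁻ φ) ξ := by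
  rw [integral_fourier_mul_eq_of_integrable hf (SchwartzMap.integrable _),
    TemperedDistribution.besselPotential, TemperedDistribution.fourierMultiplierCLM_apply_apply,
    Lp.toTemperedDistribution_apply]
  refine integral_congr_ae ?_
  filter_upwards [hf.coeFn_toL1] with x hx
  rw [hx, SchwartzMap.fourier_coe, smul_eq_mul, mul_comm]

theorem hasPolarDensity_toL1 (hn : 1 ≤ n) (s t : ℝ) {f : E n → ℂ} (hf : Integrable f) :
    HasPolarDensity s t (Lp.toTemperedDistribution (hf.toL1 f))
      fun ξ => (vWeight s t ξ : ℂ) * 𝓕 f ξ := by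
  intro φ
  have := nontrivial_E hn
  set ψ : 𝓢(E n, ℂ) := SchwartzMap.smulLeftCLM ℂ
    (fun x : E n => (((1 + ‖x‖ ^ 2) ^ ((s - t) / 2) : ℝ) : ℂ)) (𝓕⁻ φ) with hψ
  have hdensity : Measurable fun ξ : E n => ENNReal.ofReal (2 * ‖ξ‖ ^ (-((n : ℝ) - 1))) := by
    fun_prop
  have hfinite : ∀ᵐ ξ : E n, ENNReal.ofReal (2 * ‖ξ‖ ^ (-((n : ℝ) - 1))) < ∞ :=
    Eventually.of_forall fun ξ => ENNReal.ofReal_lt_top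
  have hpairing : (fun ξ => (ENNReal.ofReal (2 * ‖ξ‖ ^ (-((n : ℝ) - 1)))).toReal •
      (polarKernel n t φ ξ * ((vWeight s t ξ : ℂ) * 𝓕 f ξ))) =ᵐ[volume] fun ξ => 𝓕 f ξ * ψ ξ := by
    filter_upwards [Measure.ae_ne (volume : Measure (E n)) 0] with ξ hξ
    rw [ENNReal.toReal_ofReal (by positivity), smul_polarKernel_mul_vWeight_mul s t φ hξ, hψ,
      SchwartzMap.smulLeftCLM_apply_apply (by fun_prop), smul_eq_mul]
  have hint : Integrable fun ξ => 𝓕 f ξ * ψ ξ :=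
    ψ.integrable.bdd_mul (c := ∫ x, ‖f x‖)
      (continuous_fourier_of_integrable hf).aestronglyMeasurable
      (Eventually.of_forall (norm_fourier_le_integral_norm f))
  rw [polarMeasure_eq_withDensity hn, integrable_withDensity_iff_integrable_smul' hdensity hfinite,
    integral_withDensity_eq_integral_toReal_smul hdensity hfinite, integral_congr_ae hpairing]
  exact ⟨hint.congr hpairing.symm, besselPotential_toL1_apply _ hf φ⟩

theorem toTemperedDistribution_toL1 (f : 𝓢(E n, ℂ)) :
    Lp.toTemperedDistribution ((f.integrable (μ := volume)).toL1 (f : E n → ℂ)) =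
      (f : 𝓢'(E n, ℂ)) := by
  ext φ
  rw [Lp.toTemperedDistribution_apply, SchwartzMap.coe_apply]
  refine integral_congr_ae ?_
  filter_upwards [f.integrable.coeFn_toL1] with x hx
  rw [hx]

theorem hasPolarDensity_iff (hpq : p.HolderConjugate q)
    (hk : ∀ φ : 𝓢(E n, ℂ), MemLp (polarKernel n t φ) p (polarMeasure n))
    (H : Lp ℂ q (polarMeasure n)) :
    HasPolarDensity s t u H ↔ ∀ φ, TemperedDistribution.besselPotential (E n) ℂ (s - t) u φ =
      (ContinuousLinearMap.mul ℂ ℂ).lpPairing (polarMeasure n) p q (hk φ).toLp H := by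
  refine forall_congr' fun φ => ?_
  have hint : ∫ ξ, ((hk φ).toLp : Lp ℂ p (polarMeasure n)) ξ * H ξ ∂(polarMeasure n) =
      ∫ ξ, polarKernel n t φ ξ * H ξ ∂(polarMeasure n) := by
    refine integral_congr_ae ?_
    filter_upwards [(hk φ).coeFn_toLp] with ξ hξ
    rw [hξ]
  rw [ContinuousLinearMap.lpPairing_eq_integral]
  simp only [ContinuousLinearMap.mul_apply']
  rw [hint]
  exact and_iff_right ((hk φ).integrable_mul (Lp.memLp H))

theorem isClosed_setOf_hasPolarDensity (hpq : p.HolderConjugate q)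
    (hk : ∀ φ : 𝓢(E n, ℂ), MemLp (polarKernel n t φ) p (polarMeasure n)) :
    IsClosed {x : 𝓢'(E n, ℂ) × Lp ℂ q (polarMeasure n) | HasPolarDensity s t x.1 x.2} := by
  simp only [hasPolarDensity_iff hpq hk, ofPred_forall]
  refine isClosed_iInter fun φ => isClosed_eq ?_ ?_
  · exact ((PointwiseConvergenceCLM.evalCLM (RingHom.id ℂ) ℂ φ).continuous.comp
      (TemperedDistribution.besselPotential (E n) ℂ (s - t)).continuous).comp continuous_fst
  · exact ContinuousLinearMap.continuous _ |>.comp continuous_snd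

theorem exists_polarIsometry_eq {G : Lp ℂ q (cylinderMeasure n)} (hF : Measurable F)
    (h : G =ᵐ[cylinderMeasure n] F ∘ polarMap) :
    ∃ H : Lp ℂ q (polarMeasure n), polarIsometry n q H = G ∧ H =ᵐ[polarMeasure n] F := by
  have hmem : MemLp F q (polarMeasure n) := by
    rw [← measurePreserving_polarMap.map_eq,
      memLp_map_measure_iff (by exact hF.aestronglyMeasurable) continuous_polarMap.aemeasurable]
    exact (memLp_congr_ae h).1 (Lp.memLp G)
  exact ⟨hmem.toLp, Lp.ext ((coeFn_polarIsometry_of_ae_eq hmem.coeFn_toLp).trans h.symm),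
    hmem.coeFn_toLp⟩

section RadonTransform

variable {G G' : SinogramSpace n s t q}

theorem HasRadonTransform.exists_hasPolarDensity (hn : 1 ≤ n) (hpq : p.HolderConjugate q)
    (hk : ∀ φ : 𝓢(E n, ℂ), MemLp (polarKernel n t φ) p (polarMeasure n))
    (h : HasRadonTransform u G) :
    ∃ H : Lp ℂ q (polarMeasure n), polarIsometry n q H = G ∧ HasPolarDensity s t u H := by
  let D : Set (𝓢'(E n, ℂ) × SinogramSpace n s t q) := Prod.map id Subtype.val ⁻¹'
    (Prod.map id (polarIsometry n q) '' {x | HasPolarDensity s t x.1 x.2})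
  have hclosed : IsClosed D :=
    ((Topology.IsClosedEmbedding.id.prodMap
        (polarIsometry n q).isometry.isClosedEmbedding).isClosedMap _
      (isClosed_setOf_hasPolarDensity hpq hk)).preimage
        (continuous_id.prodMap continuous_subtype_val)
  have hmem : (u, G) ∈ D := by
    refine closure_minimal ?_ hclosed h
    rintro ⟨_, G'⟩ ⟨f, rfl, hG'⟩
    rw [weightedFourier_radon f.integrable] at hG'
    obtain ⟨H, hHG, hH⟩ :=
      exists_polarIsometry_eq (measurable_vWeight_mul_fourier s t f.integrable) hG'
    refine ⟨(_, H), ?_, Prod.ext rfl hHG⟩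
    exact toTemperedDistribution_toL1 f ▸
      (hasPolarDensity_toL1 hn s t f.integrable).congr_ae hH.symm
  obtain ⟨⟨v, H⟩, hH, hvG⟩ := hmem
  obtain ⟨rfl, hHG⟩ := Prod.mk.inj hvG
  exact ⟨H, hHG, hH⟩

theorem HasRadonTransform.unique (hn : 1 ≤ n) (hpq : p.HolderConjugate q)
    (hk : ∀ φ : 𝓢(E n, ℂ), MemLp (polarKernel n t φ) p (polarMeasure n))
    (h : HasRadonTransform u G) (h' : HasRadonTransform u G') : G = G' := by
  obtain ⟨H, hHG, hH⟩ := h.exists_hasPolarDensity hn hpq hk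
  obtain ⟨H', hHG', hH'⟩ := h'.exists_hasPolarDensity hn hpq hk
  exact Subtype.ext (hHG ▸ hHG' ▸ congrArg _ (Lp.ext (hH.ae_eq hn hH')))

theorem HasRadonTransform.enorm_eq (hn : 1 ≤ n) (hpq : p.HolderConjugate q)
    (hk : ∀ φ : 𝓢(E n, ℂ), MemLp (polarKernel n t φ) p (polarMeasure n))
    (h : HasRadonTransform u G) (hF : HasPolarDensity s t u F) :
    ‖G‖ₑ = eLpNorm F q (polarMeasure n) := by
  obtain ⟨H, hHG, hH⟩ := h.exists_hasPolarDensity hn hpq hk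
  rw [← eLpNorm_congr_ae (hH.ae_eq hn hF), ← Lp.enorm_def, ← (polarIsometry n q).enorm_map, hHG]
  rfl

end RadonTransform

end PolarDensity

section BesselNorm

variable {n : ℕ} {p q : ℝ≥0∞} [Fact (1 ≤ p)] [Fact (1 ≤ q)] {s t : ℝ} {u : 𝓢'(E n, ℂ)}

theorem le_mul_besselNorm {a : ℝ≥0∞} {C : ℝ≥0} (hC : 0 < C)
    (h : ∀ g : Lp ℂ p (volume : Measure (E n)),
      TemperedDistribution.besselPotential (E n) ℂ s u = (g : 𝓢'(E n, ℂ)) → a ≤ C * ‖g‖ₑ) :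
    a ≤ C * besselNorm s p u := by
  have hC0 : (C : ℝ≥0∞) ≠ 0 := by exact_mod_cast hC.ne'
  rw [← ENNReal.div_le_iff' hC0 ENNReal.coe_ne_top]
  refine le_iInf₂ fun g hg => ?_
  rw [ENNReal.div_le_iff' hC0 ENNReal.coe_ne_top]
  exact h g hg

theorem enorm_map_le_nnnorm_add_one {V W : Type*} [NormedAddCommGroup V] [NormedSpace ℂ V]
    [NormedAddCommGroup W] [NormedSpace ℂ W] (T : V →L[ℂ] W) (x : V) :
    ‖T x‖ₑ ≤ (‖T‖₊ + 1 : ℝ≥0) * ‖x‖ₑ := by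
  refine (T.le_opENorm x).trans ?_
  gcongr
  exact ENNReal.coe_le_coe.2 le_self_add

theorem exists_besselNorm_le_eLpNorm (hn : 1 ≤ n) (hpq : p.HolderConjugate q) (hp : 1 < p)
    (hp2 : p ≤ 2) (ht : t = (n * q.toReal - n - 1) / q.toReal) :
    ∃ C : ℝ≥0, 0 < C ∧ ∀ (s : ℝ) (u : 𝓢'(E n, ℂ)) (F : E n → ℂ),
      AEStronglyMeasurable F (polarMeasure n) → HasPolarDensity s t u F →
        besselNorm (s - t) q u ≤ C * eLpNorm F q (polarMeasure n) := by
  obtain ⟨K, hK⟩ := exists_eLpNorm_polarKernel_le hn hpq hp hp2 ht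
  obtain ⟨U, hU⟩ := exists_extension_of_eLpNorm_le (ne_top_of_le_two hp2) (polarKernel n t)
    (fun φ => (measurable_polarKernel t φ).aestronglyMeasurable) K hK
  -- `Λ H` is the functional `φ ↦ ∫ ½ |ξ|^{n-1-t} 𝓕⁻¹φ · H` on `L^p`, bounded by Paley's inequality.
  let Λ : Lp ℂ q (polarMeasure n) →L[ℂ] Lp ℂ p (volume : Measure (E n)) →L[ℂ] ℂ :=
    (ContinuousLinearMap.precomp ℂ U) ∘L
      ((ContinuousLinearMap.mul ℂ ℂ).lpPairing (polarMeasure n) p q).flip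
  refine ⟨‖Λ‖₊ + 1, by positivity, fun s u F hFm hF => ?_⟩
  by_cases hfinite : eLpNorm F q (polarMeasure n) = ∞
  · simp [hfinite]
  have hmem : MemLp F q (polarMeasure n) := ⟨hFm, lt_top_iff_ne_top.2 hfinite⟩
  obtain ⟨g, hg, hgφ⟩ := exists_Lp_repr_of_functional hpq hp hp2 (Λ hmem.toLp)
  have hu : TemperedDistribution.besselPotential (E n) ℂ (s - t) u = (g : 𝓢'(E n, ℂ)) := by
    ext φ
    rw [(hF φ).2, Lp.toTemperedDistribution_apply]
    simp only [smul_eq_mul]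
    rw [← hgφ φ]
    refine (integral_congr_ae ?_).trans (ContinuousLinearMap.lpPairing_eq_integral _ _ _).symm
    filter_upwards [hU φ, hmem.coeFn_toLp] with ξ hUξ hFξ
    rw [ContinuousLinearMap.mul_apply', ← hUξ, ← hFξ]
    rfl
  calc besselNorm (s - t) q u ≤ ‖g‖ₑ := iInf₂_le g hu
    _ ≤ ‖Λ hmem.toLp‖ₑ := by simpa only [← ofReal_norm] using ENNReal.ofReal_le_ofReal hg
    _ ≤ _ := enorm_map_le_nnnorm_add_one Λ _
    _ = _ := by rw [Lp.enorm_toLp]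

theorem inv_mul_le_of_le_mul {C : ℝ≥0} {a b : ℝ≥0∞} (hC : 0 < C) (h : a ≤ C * b) :
    ((C⁻¹ : ℝ≥0) : ℝ≥0∞) * a ≤ b := by
  rw [ENNReal.coe_inv hC.ne', mul_comm, ← div_eq_mul_inv]
  exact ENNReal.div_le_of_le_mul' h

end BesselNorm

section UpperBound

variable {n : ℕ} {p q : ℝ≥0∞} {r s t : ℝ}

/-- The Bessel potential `𝓕⁻¹ ((1 + |ξ|²)^{-s/2} 𝓕 h)` of a Schwartz function, as a Schwartz
function. -/
noncomputable def schwartzBessel (s : ℝ) : 𝓢(E n, ℂ) →L[ℂ] 𝓢(E n, ℂ) :=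
  SchwartzMap.fourierMultiplierCLM ℂ fun x : E n => (((1 + ‖x‖ ^ 2) ^ (-s / 2) : ℝ) : ℂ)

theorem fourier_schwartzBessel (s : ℝ) (h : 𝓢(E n, ℂ)) (ξ : E n) :
    𝓕 (schwartzBessel s h : E n → ℂ) ξ =
      (((1 + ‖ξ‖ ^ 2) ^ (-s / 2) : ℝ) : ℂ) * 𝓕 (h : E n → ℂ) ξ := by
  rw [← SchwartzMap.fourier_coe, ← SchwartzMap.fourier_coe, schwartzBessel,
    SchwartzMap.fourierMultiplierCLM_apply, FourierTransform.fourier_fourierInv_eq,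
    SchwartzMap.smulLeftCLM_apply_apply (by fun_prop), smul_eq_mul]

theorem toTemperedDistribution_schwartzBessel (s : ℝ) (h : 𝓢(E n, ℂ)) :
    (schwartzBessel s h : 𝓢'(E n, ℂ)) =
      TemperedDistribution.besselPotential (E n) ℂ (-s) (h : 𝓢'(E n, ℂ)) := by
  rw [TemperedDistribution.besselPotential, schwartzBessel,
    TemperedDistribution.fourierMultiplierCLM_toTemperedDistributionCLM_eq (by fun_prop)]

/-- The map `h ↦ v_{r,t} (1 + |ξ|²)^{-s/2} 𝓕 h`, which sends `h` to the polar density of its Bessel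
potential of order `-s`. -/
noncomputable def polarMultiplier (n : ℕ) (r s t : ℝ) : 𝓢(E n, ℂ) →ₗ[ℂ] E n → ℂ where
  toFun h ξ := (vWeight r t ξ : ℂ) * 𝓕 (schwartzBessel s h) ξ
  map_add' h h' := by ext ξ; simp [FourierTransform.fourier_add, mul_add]
  map_smul' c h := by ext ξ; simp [FourierTransform.fourier_smul, mul_left_comm]

theorem measurable_polarMultiplier (h : 𝓢(E n, ℂ)) : Measurable (polarMultiplier n r s t h) :=
  measurable_vWeight_mul_fourier r t (schwartzBessel s h).integrable

theorem norm_rpow_mul_one_add_norm_sq_rpow_le_one {V : Type*} [NormedAddCommGroup V] {a : ℝ}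
    (ha : 0 ≤ a) (ξ : V) : ‖ξ‖ ^ a * (1 + ‖ξ‖ ^ 2) ^ (-(a / 2)) ≤ 1 := by
  rw [Real.rpow_neg (by positivity), ← div_eq_mul_inv, div_le_one₀ (by positivity)]
  calc ‖ξ‖ ^ a = (‖ξ‖ ^ 2) ^ (a / 2) := by
        rw [← Real.rpow_natCast, ← Real.rpow_mul (norm_nonneg ξ)]; congr 1; push_cast; ring
    _ ≤ _ := Real.rpow_le_rpow (by positivity) (by linarith) (by linarith)

theorem norm_rpow_mul_polarMultiplier_le {Q : ℝ} (hQ : 2 ≤ Q) (ht : t = (n * Q - n - 1) / Q)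
    (hr : r = s + (n - 1) / Q) (h : 𝓢(E n, ℂ)) {ξ : E n} (hξ : ξ ≠ 0) :
    ‖((‖ξ‖ ^ (-((n : ℝ) - 1) / Q) : ℝ) : ℂ) * polarMultiplier n r s t h ξ‖ ≤
      ‖𝓕 (h : E n → ℂ) ξ‖ := by
  have hξ0 : 0 < ‖ξ‖ := norm_pos_iff.2 hξ
  have hJ : 0 < 1 + ‖ξ‖ ^ 2 := by positivity
  have hQ0 : Q ≠ 0 := by positivity
  set a : ℝ := n * (Q - 2) / Q with ha
  have ha0 : 0 ≤ a := div_nonneg (mul_nonneg (by positivity) (by linarith)) (by linarith)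
  have hnorm_exp : -((n : ℝ) - 1) / Q + t = a := by rw [ht, ha]; field_simp; ring
  have hbracket_exp : (r - t) / 2 + -s / 2 = -(a / 2) := by rw [hr, ht, ha]; field_simp; ring
  have hweight : ‖ξ‖ ^ (-((n : ℝ) - 1) / Q) * (vWeight r t ξ * (1 + ‖ξ‖ ^ 2) ^ (-s / 2)) ≤ 1 := by
    convert norm_rpow_mul_one_add_norm_sq_rpow_le_one ha0 ξ using 1
    rw [vWeight_eq, ← hnorm_exp, Real.rpow_add hξ0, hnorm_exp, ← hbracket_exp, Real.rpow_add hJ]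
    ring
  change ‖_ * ((vWeight r t ξ : ℂ) * 𝓕 (schwartzBessel s h : E n → ℂ) ξ)‖ ≤ _
  rw [fourier_schwartzBessel, ← mul_assoc, ← mul_assoc, norm_mul]
  refine mul_le_of_le_one_left (norm_nonneg _) (le_of_eq_of_le ?_ hweight)
  rw [← Complex.ofReal_mul, ← Complex.ofReal_mul, Complex.norm_real, mul_assoc]
  exact Real.norm_of_nonneg (mul_nonneg (by positivity)
    (mul_nonneg (vWeight_pos r t hξ).le (by positivity)))

theorem eLpNorm_polarMultiplier_le (hn : 1 ≤ n) (hpq : p.HolderConjugate q) (hp : 1 < p)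
    (hp2 : p ≤ 2) (ht : t = (n * q.toReal - n - 1) / q.toReal)
    (hr : r = s + (n - 1) / q.toReal) (h : 𝓢(E n, ℂ)) :
    eLpNorm (polarMultiplier n r s t h) q (polarMeasure n) ≤
      (2 ^ (1 / q.toReal) * paleyConst p.toReal ^ (1 / p.toReal) : ℝ≥0) *
        eLpNorm h p volume := by
  have := nontrivial_E hn
  have hQ := two_le_conjExponent_toReal hpq hp hp2
  rw [eLpNorm_polarMeasure hn hpq.symm.ne_zero (conjExponent_ne_top hpq hp)
    (measurable_polarMultiplier h), ENNReal.coe_mul, ENNReal.coe_rpow_of_nonneg _ (by positivity),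
    ENNReal.coe_rpow_of_nonneg _ (by positivity), ENNReal.coe_ofNat, mul_assoc]
  gcongr
  refine (eLpNorm_mono_ae ?_).trans (eLpNorm_fourier_le hpq hp hp2 h)
  filter_upwards [Measure.ae_ne (volume : Measure (E n)) 0] with ξ hξ
  exact norm_rpow_mul_polarMultiplier_le hQ ht hr h hξ

variable [Fact (1 ≤ p)] [Fact (1 ≤ q)]

theorem hasRadonTransform_of_polarIsometry_eq (hp : p ≠ ∞) (htop : SinogramSpace n r t q = ⊤)
    {U : Lp ℂ p (volume : Measure (E n)) →L[ℂ] Lp ℂ q (polarMeasure n)}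
    (hU : ∀ h : 𝓢(E n, ℂ), U (h.toLp p) =ᵐ[polarMeasure n] polarMultiplier n r s t h)
    {u : 𝓢'(E n, ℂ)} {h : Lp ℂ p (volume : Measure (E n))}
    (hu : TemperedDistribution.besselPotential (E n) ℂ s u = (h : 𝓢'(E n, ℂ)))
    {G : SinogramSpace n r t q} (hG : polarIsometry n q (U h) = G) : HasRadonTransform u G := by
  let Φ (h : Lp ℂ p (volume : Measure (E n))) : 𝓢'(E n, ℂ) × SinogramSpace n r t q :=
    (TemperedDistribution.besselPotential (E n) ℂ (-s) (h : 𝓢'(E n, ℂ)),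
      ⟨polarIsometry n q (U h), htop ▸ Submodule.mem_top⟩)
  have hΦ : Continuous Φ := by
    refine Continuous.prodMk ?_ (((polarIsometry n q).continuous.comp U.continuous).subtype_mk _)
    exact (TemperedDistribution.besselPotential (E n) ℂ (-s)).continuous.comp
      (Lp.toTemperedDistributionCLM ℂ volume p).continuous
  have hΦh : Φ h = (u, G) :=
    Prod.ext ((TemperedDistribution.besselPotential_neg_apply_eq_iff s _ _).2 hu) (Subtype.ext hG)
  have hdense : DenseRange fun φ : 𝓢(E n, ℂ) => φ.toLp p (volume : Measure (E n)) :=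
    SchwartzMap.denseRange_toLpCLM hp
  rw [HasRadonTransform, ← hΦh]
  refine map_mem_closure hΦ (hdense h) ?_
  rintro _ ⟨φ, rfl⟩
  refine ⟨schwartzBessel s φ, ?_, ?_⟩
  · rw [toTemperedDistribution_schwartzBessel, ← Lp.toTemperedDistribution_toLp_eq (p := p)]
  · rw [weightedFourier_radon (SchwartzMap.integrable _)]
    exact coeFn_polarIsometry_of_ae_eq (hU φ)

theorem exists_hasRadonTransform_enorm_le (hn : 1 ≤ n) (hpq : p.HolderConjugate q) (hp : 1 < p)
    (hp2 : p ≤ 2) (ht : t = (n * q.toReal - n - 1) / q.toReal)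
    (hr : r = s + (n - 1) / q.toReal) :
    ∃ C : ℝ≥0, 0 < C ∧ ∀ (u : 𝓢'(E n, ℂ)) (h : Lp ℂ p (volume : Measure (E n))),
      TemperedDistribution.besselPotential (E n) ℂ s u = (h : 𝓢'(E n, ℂ)) →
        ∃ G : SinogramSpace n r t q, HasRadonTransform u G ∧ ‖G‖ₑ ≤ C * ‖h‖ₑ := by
  have hp_top := ne_top_of_le_two hp2
  have ht0 : 0 ≤ t := by
    have hn' : (1 : ℝ) ≤ n := by exact_mod_cast hn
    have hQ := two_le_conjExponent_toReal hpq hp hp2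
    rw [ht]
    exact div_nonneg (by nlinarith) (by linarith)
  have htop : SinogramSpace n r t q = ⊤ :=
    sinogramSpace_eq_top r ht0 (conjExponent_ne_top hpq hp)
  obtain ⟨U, hU⟩ := exists_extension_of_eLpNorm_le hp_top (polarMultiplier n r s t)
    (fun h => (measurable_polarMultiplier h).aestronglyMeasurable) _
    (eLpNorm_polarMultiplier_le hn hpq hp hp2 ht hr)
  refine ⟨‖U‖₊ + 1, by positivity, fun u h hu =>
    ⟨⟨polarIsometry n q (U h), htop ▸ Submodule.mem_top⟩,
      hasRadonTransform_of_polarIsometry_eq hp_top htop hU hu rfl, ?_⟩⟩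
  exact ((polarIsometry n q).enorm_map (U h)).trans_le (enorm_map_le_nnnorm_add_one U h)

end UpperBound

end RadonBessel

open RadonBessel in
theorem mainTheorem2_general (n : ℕ) (hn : 1 ≤ n) (p p' : ℝ≥0∞) [Fact (1 ≤ p)] [Fact (1 ≤ p')]
    (hpp' : p.HolderConjugate p') (hp : 1 < p) (hp2 : p ≤ 2) (s : ℝ) :
    ∃ c C : ℝ≥0, 0 < c ∧ 0 < C ∧
      (∀ (f : E n → ℂ) (hf : Integrable f volume),
        (c : ℝ≥0∞) * besselNorm (s - (n : ℝ) * (p'.toReal - 2) / p'.toReal) p'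
              (Lp.toTemperedDistribution (hf.toL1 f))
            ≤ sinogramNorm (s + ((n : ℝ) - 1) / p'.toReal)
                (((n : ℝ) * p'.toReal - n - 1) / p'.toReal) p' (radon f) ∧
          sinogramNorm (s + ((n : ℝ) - 1) / p'.toReal)
                (((n : ℝ) * p'.toReal - n - 1) / p'.toReal) p' (radon f)
            ≤ (C : ℝ≥0∞) * besselNorm s p
                (Lp.toTemperedDistribution (hf.toL1 f))) ∧
      (∀ u : 𝓢'(E n, ℂ), TemperedDistribution.MemSobolev s p u →
        ∃! G : SinogramSpace n (s + ((n : ℝ) - 1) / p'.toReal)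
            (((n : ℝ) * p'.toReal - n - 1) / p'.toReal) p',
          HasRadonTransform u G) ∧
      (∀ (u : 𝓢'(E n, ℂ))
          (G : SinogramSpace n (s + ((n : ℝ) - 1) / p'.toReal)
            (((n : ℝ) * p'.toReal - n - 1) / p'.toReal) p'),
        HasRadonTransform u G →
          (c : ℝ≥0∞) * besselNorm (s - (n : ℝ) * (p'.toReal - 2) / p'.toReal) p' u
              ≤ ‖G‖ₑ ∧
            ‖G‖ₑ ≤ (C : ℝ≥0∞) * besselNorm s p u) := by
  have hQtop := conjExponent_ne_top hpp' hp
  have hQ : p'.toReal ≠ 0 := (zero_lt_two.trans_le (two_le_conjExponent_toReal hpp' hp hp2)).ne'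
  have horder : s - n * (p'.toReal - 2) / p'.toReal =
      s + (n - 1) / p'.toReal - (n * p'.toReal - n - 1) / p'.toReal := by
    field_simp
    ring
  rw [horder]
  have hk := memLp_polarKernel hn hpp' hp hp2 rfl
  obtain ⟨C₁, hC₁, hlower⟩ := exists_besselNorm_le_eLpNorm hn hpp' hp hp2 rfl
  obtain ⟨C₂, hC₂, hupper⟩ := exists_hasRadonTransform_enorm_le (s := s) hn hpp' hp hp2 rfl rfl
  refine ⟨C₁⁻¹, C₂, inv_pos.2 hC₁, hC₂, fun f hf => ?_, fun u ⟨h, hu⟩ => ?_, fun u G hG => ?_⟩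
  · have hF := hasPolarDensity_toL1 hn (s + (n - 1) / p'.toReal)
      ((n * p'.toReal - n - 1) / p'.toReal) hf
    rw [sinogramNorm_radon hf _ _ hpp'.symm.ne_zero hQtop]
    refine ⟨inv_mul_le_of_le_mul hC₁ (hlower _ _ _
      (measurable_vWeight_mul_fourier _ _ hf).aestronglyMeasurable hF),
      le_mul_besselNorm hC₂ fun h hu => ?_⟩
    obtain ⟨G, hG, hGh⟩ := hupper _ h hu
    exact (hG.enorm_eq hn hpp' hk hF).symm.trans_le hGh
  · obtain ⟨G, hG, -⟩ := hupper u h hu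
    exact ⟨G, hG, fun G' hG' => hG'.unique hn hpp' hk hG⟩
  · obtain ⟨H, -, hH⟩ := hG.exists_hasPolarDensity hn hpp' hk
    refine ⟨inv_mul_le_of_le_mul hC₁ ?_, le_mul_besselNorm hC₂ fun h hu => ?_⟩
    · rw [hG.enorm_eq hn hpp' hk hH]
      exact hlower _ _ _ (Lp.aestronglyMeasurable H) hH
    · obtain ⟨G', hG', hGh⟩ := hupper u h hu
      rwa [hG.unique hn hpp' hk hG']

theorem mainTheorem2 (n : ℕ) (hn : 1 ≤ n) (p p' : ℝ≥0∞) [Fact (1 ≤ p)] [Fact (1 ≤ p')]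
    (hpp' : p.HolderConjugate p') (hp : 1 < p) (hp2 : p ≤ 2)
    (s : ℝ) (hs : (n : ℝ) * (p'.toReal - 2) / p'.toReal ≤ s) :
    ∃ c C : ℝ≥0, 0 < c ∧ 0 < C ∧
      -- classical Radon transform of integrable functions
      (∀ (f : RadonBessel.E n → ℂ) (hf : Integrable f volume),
        (c : ℝ≥0∞) * RadonBessel.besselNorm (s - (n : ℝ) * (p'.toReal - 2) / p'.toReal) p'
              (Lp.toTemperedDistribution (hf.toL1 f))
            ≤ RadonBessel.sinogramNorm (s + ((n : ℝ) - 1) / p'.toReal)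
                (((n : ℝ) * p'.toReal - n - 1) / p'.toReal) p' (RadonBessel.radon f) ∧
          RadonBessel.sinogramNorm (s + ((n : ℝ) - 1) / p'.toReal)
                (((n : ℝ) * p'.toReal - n - 1) / p'.toReal) p' (RadonBessel.radon f)
            ≤ (C : ℝ≥0∞) * RadonBessel.besselNorm s p
                (Lp.toTemperedDistribution (hf.toL1 f))) ∧
      -- every element of the Bessel potential space has exactly one Radon transform
      (∀ u : 𝓢'(RadonBessel.E n, ℂ), TemperedDistribution.MemSobolev s p u →
        ∃! G : RadonBessel.SinogramSpace n (s + ((n : ℝ) - 1) / p'.toReal)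
            (((n : ℝ) * p'.toReal - n - 1) / p'.toReal) p',
          RadonBessel.HasRadonTransform u G) ∧
      -- the bounds for the Radon transform in the sinogram space
      (∀ (u : 𝓢'(RadonBessel.E n, ℂ))
          (G : RadonBessel.SinogramSpace n (s + ((n : ℝ) - 1) / p'.toReal)
            (((n : ℝ) * p'.toReal - n - 1) / p'.toReal) p'),
        RadonBessel.HasRadonTransform u G →
          (c : ℝ≥0∞) * RadonBessel.besselNorm (s - (n : ℝ) * (p'.toReal - 2) / p'.toReal) p' u
              ≤ ‖G‖ₑ ∧
            ‖G‖ₑ ≤ (C : ℝ≥0∞) * RadonBessel.besselNorm s p u) :=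
  mainTheorem2_general n hn p p' hpp' hp hp2 s
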